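/- \textbf{Setting.} Let $m\ge 1$, $\mathscr C=[0,1]^m$, and write $\hat q(\mathbf k)=\int_{\mathscr C}q(\mathbf x)e^{-i2\pi \mathbf k\cdot\mathbf x}\,d\mathbf x$ for $\mathbf k\in\mathbb Z^m$. For $s>0$ let $\mathcal M(s)$ be the set of real $q\in L^2(\mathscr C)$ with $\sum_{\mathbf k}(1+\|\mathbf k\|^2)^s|\hat q(\mathbf k)|^2<\infty$ and $\sum_{\mathbf k}\|\mathbf k\|^s|\hat q(\mathbf k)|<\infty$ (Euclidean norm). Let $\theta\in L^2(\mathscr C)$, let $\psi\ge 0$ be a $\mathbb Z^m$-periodic function, square integrable on $\mathscr C$ with $\int_{\mathscr C}\psi=1$, and put $K\theta(\mathbf x)=\int_{\mathscr C}\theta(\mathbf u)\psi(\mathbf x-\mathbf u)\,d\mathbf u$. Observe $Y_j=K\theta(X_j)+\varepsilon_j$, where $X_1,X_2,\dots$ are i.i.d. with values in $\mathscr C$, the errors $\varepsilon_1,\varepsilon_2,\dots$ are i.i.d. with mean zero, variance $\sigma^2$ (when it is finite) and a Lebesgue density, and the sequences $(X_j)$ and $(\varepsilon_j)$ are independent.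 Let $c_n>0$ and $\Lambda:\mathbb R^m\to\mathbb R$, and define $$W_{c_n}(\mathbf x)=\sum_{\mathbf k\in\mathbb Z^m}\Lambda(c_n\mathbf k)e^{i2\pi\mathbf k\cdot\mathbf x},\qquad \hat g(\mathbf x)=\frac1n\sum_{j=1}^nW_{c_n}(\mathbf x-X_j),\qquad \hat R(\mathbf k)=\frac1n\sum_{j=1}^n\frac{Y_j}{\hat g(X_j)}e^{-i2\pi\mathbf k\cdot X_j},$$ $$\widehat{K\theta}(\mathbf x)=\sum_{\mathbf k\in\mathbb Z^m}\Lambda(c_n\mathbf k)\hat R(\mathbf k)e^{i2\pi\mathbf k\cdot\mathbf x},\qquad \hat\sigma^2=\frac1n\sum_{j=1}^n\big|Y_j-\widehat{K\theta}(X_j)\big|^2 .$$ \textbf{Proposition.} Suppose that $\Lambda$ is radially symmetric, i.e. $\Lambda(\mathbf u)$ depends only on $\|\mathbf u\|$. (i) For every $n$ and every sample for which the estimator is defined (i.e. $\sum_{\mathbf k}|\Lambda(c_n\mathbf k)|<\infty$ and $\hat g(X_j)\neq0$ for $1\le j\le n$), $$\bigg|\frac1n\sum_{j=1}^n\big\{\widehat{K\theta}(X_j)-K\theta(X_j)\big\}-\frac1n\sum_{j=1}^n\varepsilon_j\bigg|=0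 .$$ (ii) Suppose in addition that, for some $s_0>0$, $b\ge0$ and $\kappa>2$ with $s_0+b>3m/2$: - $\theta\in\mathcal M(s_0)$; - there are $\gamma>0$ and $0\le C<C^*<\infty$ with $C\le\|\mathbf k\|^b|\hat\psi(\mathbf k)|<C^*$ whenever $\|\mathbf k\|>\gamma$; - $\Lambda(\mathbf u)=1$ for $\|\mathbf u\|\le1$, $|\Lambda(\mathbf u)|\le1$ for $\|\mathbf u\|>1$, $\int\|\mathbf u\||\Lambda(\mathbf u)|\,d\mathbf u<\infty$ and $\int\|\mathbf u\|^{\max\{s_0+b,1\}}|\Lambda(\mathbf u)|\,d\mathbf u<\infty$, and the Riemann sums $c_n^m\sum_{\mathbf k\in\mathbb Z^m}\|c_n\mathbf k\||\Lambda(c_n\mathbf k)|$ are finite and bounded for all large $n$; - $X_1$ has a Lebesgue density $g\in\mathcal M(s_0+b+m)$ on $\mathscr C$ with $\inf_{\mathscr C}g>0$ and $\sup_{\mathscr C}g<\infty$; - $E|\varepsilon_1|^\kappa<\infty$; - $c_n$ is of the exact order $n^{-1/(2s_0+2b+3m)}\log^{1/(2s_0+2b+3m)}(n)$, i.e. the ratio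 is bounded and bounded away from zero for all large $n$. Then, almost surely, $\hat g(X_j)\ne0$ for all $1\le j\le n$ and all sufficiently large $n$, and $$\bigg|\hat\sigma^2-\sigma^2-\frac1n\sum_{j=1}^n\{\varepsilon_j^2-\sigma^2\}\bigg|=o(n^{-1/2})\quad\text{a.s.}$$ -/

import Mathlib

open MeasureTheory ProbabilityTheory Filter Asymptotics

noncomputable section

/-- The design space `[0,1]^m`, as a subset of Euclidean space. -/
def unitCube (m : ℕ) : Set (EuclideanSpace ℝ (Fin m)) :=
  {x | ∀ i, x i ∈ Set.Icc (0 : ℝ) 1}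

/-- The vector `k ∈ ℤ^m`, seen as a point of Euclidean space. -/
def latticePoint {m : ℕ} (k : Fin m → ℤ) : EuclideanSpace ℝ (Fin m) :=
  WithLp.toLp 2 fun i => (k i : ℝ)

/-- The Fourier basis function `x ↦ exp(i 2π k·x)`. -/
def fourierChar {m : ℕ} (k : Fin m → ℤ) (x : EuclideanSpace ℝ (Fin m)) : ℂ :=
  Complex.exp (Complex.I * 2 * Real.pi * ((∑ i, (k i : ℝ) * x i : ℝ) : ℂ))

/-- The Fourier coefficient `∫_{[0,1]^m} q(x) exp(-i 2π k·x) dx`. -/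
def cubeCoeff {m : ℕ} (q : EuclideanSpace ℝ (Fin m) → ℝ) (k : Fin m → ℤ) : ℂ :=
  ∫ x in unitCube m, (q x : ℂ) * fourierChar (-k) x

/-- The class `M(s)`: functions `q ∈ L²([0,1]^m)` in the periodic Sobolev space of (real) order `s`,
described through the Fourier coefficients, with `∑ ‖k‖^s |q̂(k)| < ∞`. -/
structure MemSmoothClass {m : ℕ} (s : ℝ) (q : EuclideanSpace ℝ (Fin m) → ℝ) : Prop where
  memLp : MemLp q 2 (volume.restrict (unitCube m))
  sobolev : Summable fun k : Fin m → ℤ =>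
    (1 + ‖latticePoint k‖ ^ 2) ^ s * ‖cubeCoeff q k‖ ^ 2
  summable : Summable fun k : Fin m → ℤ => ‖latticePoint k‖ ^ s * ‖cubeCoeff q k‖

/-- A distortion function: a `ℤ^m`-periodic nonnegative function, square integrable over the unit
cube and with integral one there. -/
structure IsDistortion {m : ℕ} (ψ : EuclideanSpace ℝ (Fin m) → ℝ) : Prop where
  periodic : ∀ (k : Fin m → ℤ) (x : EuclideanSpace ℝ (Fin m)), ψ (x + latticePoint k) = ψ x
  nonneg : ∀ x, 0 ≤ ψ x
  memLp : MemLp ψ 2 (volume.restrict (unitCube m))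
  integral_eq_one : ∫ x in unitCube m, ψ x = 1

/-- The convolution `[Kθ](x) = ∫_{[0,1]^m} θ(u) ψ(x - u) du`. -/
def convOp {m : ℕ} (ψ θ : EuclideanSpace ℝ (Fin m) → ℝ) (x : EuclideanSpace ℝ (Fin m)) : ℝ :=
  ∫ u in unitCube m, θ u * ψ (x - u)

/-- The inverse problem is mildly to moderately ill-posed of degree `b`. -/
def IllPosedOfDegree {m : ℕ} (b : ℝ) (ψ : EuclideanSpace ℝ (Fin m) → ℝ) : Prop :=
  0 ≤ b ∧ ∃ γ C C' : ℝ, 0 < γ ∧ 0 ≤ C ∧ C < C' ∧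
    ∀ k : Fin m → ℤ, γ < ‖latticePoint k‖ →
      C ≤ ‖latticePoint k‖ ^ b * ‖cubeCoeff ψ k‖ ∧
        ‖latticePoint k‖ ^ b * ‖cubeCoeff ψ k‖ < C'

/-- The standing assumption on a (real-valued) Fourier smoothing kernel. -/
structure IsFourierKernel {m : ℕ} (Λ : EuclideanSpace ℝ (Fin m) → ℝ) : Prop where
  eq_one : ∀ u, ‖u‖ ≤ 1 → Λ u = 1
  abs_le_one : ∀ u, 1 < ‖u‖ → |Λ u| ≤ 1
  integrable : Integrable fun u => ‖u‖ * |Λ u|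

/-- `Λ(u)` depends on `‖u‖` only. -/
def RadiallySymmetric {m : ℕ} (Λ : EuclideanSpace ℝ (Fin m) → ℝ) : Prop :=
  ∀ u v, ‖u‖ = ‖v‖ → Λ u = Λ v

/-- For mesh sizes `c n`, the lattice sums `(c n)^m ∑_k ‖c n k‖ |Λ(c n k)|`, which are Riemann sums
of `∫ ‖u‖ |Λ(u)| du`, are finite and bounded for all large `n`. -/
def BoundedRiemannSums {m : ℕ} (Λ : EuclideanSpace ℝ (Fin m) → ℝ) (c : ℕ → ℝ) : Prop :=
  ∃ B : ℝ, ∀ᶠ n in atTop,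
    (Summable fun k : Fin m → ℤ => ‖c n • latticePoint k‖ * |Λ (c n • latticePoint k)|) ∧
      c n ^ m * ∑' k : Fin m → ℤ, ‖c n • latticePoint k‖ * |Λ (c n • latticePoint k)| ≤ B

/-- `g` is a density on the unit cube, bounded and bounded away from zero, in the class `M(s)`. -/
structure IsRegularDensity {m : ℕ} (s : ℝ) (g : EuclideanSpace ℝ (Fin m) → ℝ) : Prop where
  bounded_below : ∃ a : ℝ, 0 < a ∧ ∀ x ∈ unitCube m, a ≤ g x
  bounded_above : ∃ A : ℝ, ∀ x ∈ unitCube m, g x ≤ A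
  memSmoothClass : MemSmoothClass s g

/-- The smoothing weights `W_c(x) = ∑_k Λ(c k) exp(i 2π k·x)`. -/
def smoothingWeight {m : ℕ} (Λ : EuclideanSpace ℝ (Fin m) → ℝ) (c : ℝ)
    (x : EuclideanSpace ℝ (Fin m)) : ℂ :=
  ∑' k : Fin m → ℤ, (Λ (c • latticePoint k) : ℂ) * fourierChar k x

/-- The density estimator `ĝ(t) = n⁻¹ ∑_{j<n} W_c(t - x_j)` from the first `n` design points. -/
def densityEst {m : ℕ} (Λ : EuclideanSpace ℝ (Fin m) → ℝ) (c : ℝ) (n : ℕ)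
    (x : ℕ → EuclideanSpace ℝ (Fin m)) (t : EuclideanSpace ℝ (Fin m)) : ℂ :=
  (1 / (n : ℂ)) * ∑ j ∈ Finset.range n, smoothingWeight Λ c (t - x j)

/-- The estimator `R̂(k) = n⁻¹ ∑_{j<n} y_j / ĝ(x_j) exp(-i 2π k·x_j)` of the Fourier coefficients of
the distorted regression function. -/
def coeffEst {m : ℕ} (Λ : EuclideanSpace ℝ (Fin m) → ℝ) (c : ℝ) (n : ℕ)
    (x : ℕ → EuclideanSpace ℝ (Fin m)) (y : ℕ → ℝ) (k : Fin m → ℤ) : ℂ :=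
  (1 / (n : ℂ)) * ∑ j ∈ Finset.range n,
    (y j : ℂ) / densityEst Λ c n x (x j) * fourierChar (-k) (x j)

/-- The regression estimator `∑_k Λ(c k) R̂(k) exp(i 2π k·t)`. For a radially symmetric (real) `Λ`
its values are real. -/
def regressionEst {m : ℕ} (Λ : EuclideanSpace ℝ (Fin m) → ℝ) (c : ℝ) (n : ℕ)
    (x : ℕ → EuclideanSpace ℝ (Fin m)) (y : ℕ → ℝ) (t : EuclideanSpace ℝ (Fin m)) : ℂ :=
  ∑' k : Fin m → ℤ, (Λ (c • latticePoint k) : ℂ) * coeffEst Λ c n x y k * fourierChar k t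

/-- The residual of the `j`-th observation. -/
def regressionResidual {m : ℕ} (Λ : EuclideanSpace ℝ (Fin m) → ℝ) (c : ℝ) (n : ℕ)
    (x : ℕ → EuclideanSpace ℝ (Fin m)) (y : ℕ → ℝ) (j : ℕ) : ℂ :=
  (y j : ℂ) - regressionEst Λ c n x y (x j)

/-- The residual standard deviation `{n⁻¹ ∑_{j<n} |residual_j|²}^{1/2}`. -/
def sigmaHat {m : ℕ} (Λ : EuclideanSpace ℝ (Fin m) → ℝ) (c : ℝ) (n : ℕ)
    (x : ℕ → EuclideanSpace ℝ (Fin m)) (y : ℕ → ℝ) : ℝ :=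
  Real.sqrt ((1 / (n : ℝ)) * ∑ j ∈ Finset.range n, ‖regressionResidual Λ c n x y j‖ ^ 2)

end

/-!
The smoothing matrix of the estimator has the entries `S j i = W_c(x_j - x_i) / (n ĝ(x_i))`. For a
radially symmetric kernel `W_c` is even, so the columns of `S` sum to one and smoothing preserves
the mean of the observations (`mean_regressionEst`). This is the first assertion.

For the second, write `f = Kθ` and `D = S ε + d`, where `d = (S - 1) f` is the smoothing error for
noiseless data. The residuals are `ε - D`, so the residual variance differs from `n⁻¹ ∑ ε_j²` by
`n⁻¹ ∑ |D_j|²` and twice `n⁻¹ ∑ ε_j D_j`. Both are shown to be of order `v²` for a rate `v` with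
`v² = o(n^{-1/2})` (`abs_sigmaHat_sq_sub_le`).

Everything is done on the Fourier side. The smoother of a vector `u` is the Fourier series with
coefficients `Λ(c k) û(k)`, where `û(k) = n⁻¹ ∑ u_i exp(-i 2π k·x_i)`, and there are about `c^{-m}`
relevant frequencies. It therefore suffices to know, uniformly in `k`, that the empirical
coefficients of the design, of `f / g`, of the errors, and of the errors divided by `ĝ` are within
`n^{-1/2} log n (1 + ‖c k‖)^{1/2}` of their means. This follows from an exponential inequality and
the Borel–Cantelli lemma over pairs `(n, k)` (`ae_eventually_forall_abs_sum_le`), after truncation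
of the errors, which need only a second moment (`ae_eventually_norm_weighted_sum_le`). Weights that
depend on the design are handled by conditioning on it
(`ae_eventually_norm_weighted_sum_le_of_indepFun`).

These bounds give `S ε = O(c^{-m} n^{-1/2} log n)` in supremum norm and
`n⁻¹ ∑ ε_j (S ε)_j = O(c^{-m} n^{-1} log² n)`. For `d`, the density estimate has an error `ρ` of
order `c^{-m} n^{-1/2} log n + c^{t+m}`, with `t = s₀ + b`, and exchanging `ĝ` for `g` in `S f`
costs `ρ` times the norm of the smoother on bounded vectors. By Cauchy–Schwarz that norm is of order
`c^{-m/2}`, because the Fourier coefficients of `g` are summable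
(`mean_norm_smoothingWeight_sq_le`). Hence `d = O(c^t + c^{-3m/2} n^{-1/2} log n)`. The prescribed
order of `c` balances the two terms, and `t > 3m/2` makes them smaller than `n^{-1/4}` by a power
of `n` (`exists_rateBounds`). The linear form `n⁻¹ ∑ ε_j d_j` is again a weighted sum of the errors,
with the weights `d_j / v`.

Pointwise statements about `f` and `g` at the design points come from their Fourier series: that of
`g` holds almost everywhere (`ae_eq_tsum_cubeCoeff`), that of the convolution `f` everywhere, by
Parseval's identity (`hasSum_convOp`).
-/

/-! ### Fourier series on the unit cube -/

section Torus

-- The torus carries its Haar probability measure.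
attribute [local instance] instMeasureSpaceUnitAddCircle
  instIsAddHaarMeasureUnitAddCircleVolume instIsProbabilityMeasureUnitAddCircleVolume
open UnitAddTorus

/-- The projection of Euclidean space onto the torus. -/
noncomputable def toTorus {m : ℕ} (x : EuclideanSpace ℝ (Fin m)) : UnitAddTorus (Fin m) :=
  fun i => (x i : UnitAddCircle)

/-- The representative in `(0,1]^m` of a point of the torus. -/
noncomputable def cubeRep {m : ℕ} (y : UnitAddTorus (Fin m)) : EuclideanSpace ℝ (Fin m) :=
  WithLp.toLp 2 fun i => ((AddCircle.equivIoc (1 : ℝ) 0 (y i) : Set.Ioc (0 : ℝ) (0 + 1)) : ℝ)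

lemma toTorus_cubeRep {m : ℕ} (y : UnitAddTorus (Fin m)) : toTorus (cubeRep y) = y := by
  funext i
  simp [toTorus, cubeRep, AddCircle.coe_equivIoc]

lemma toTorus_sub {m : ℕ} (x y : EuclideanSpace ℝ (Fin m)) :
    toTorus (x - y) = toTorus x - toTorus y := by
  funext i
  simp [toTorus]

lemma measurable_toTorus {m : ℕ} : Measurable (toTorus (m := m)) := by
  refine measurable_pi_lambda _ fun i => ?_
  have h : Measurable fun x : EuclideanSpace ℝ (Fin m) => x i := by fun_prop
  exact AddCircle.measurable_mk'.comp h

lemma measurable_cubeRep {m : ℕ} : Measurable (cubeRep (m := m)) := by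
  unfold cubeRep
  refine (WithLp.measurable_toLp 2 _).comp (measurable_pi_lambda _ fun i => ?_)
  exact measurable_subtype_coe.comp
    ((AddCircle.measurableEquivIoc (1 : ℝ) 0).measurable.comp (measurable_pi_apply i))

lemma exists_latticePoint_of_toTorus_eq {m : ℕ} {x y : EuclideanSpace ℝ (Fin m)}
    (h : toTorus x = toTorus y) : ∃ k : Fin m → ℤ, x = y + latticePoint k := by
  have h1 : ∀ i, ∃ n : ℤ, x i = y i + n := by
    intro i
    have h2 : ((x i : ℝ) : UnitAddCircle) = ((y i : ℝ) : UnitAddCircle) := congrFun h i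
    rw [← sub_eq_zero, ← AddCircle.coe_sub, AddCircle.coe_eq_zero_iff] at h2
    obtain ⟨n, hn⟩ := h2
    refine ⟨n, ?_⟩
    simp only [zsmul_eq_mul, mul_one] at hn
    linarith
  choose n hn using h1
  refine ⟨n, ?_⟩
  ext i
  simp [latticePoint, hn i]

lemma mFourier_toTorus {m : ℕ} (k : Fin m → ℤ) (x : EuclideanSpace ℝ (Fin m)) :
    mFourier k (toTorus x) = fourierChar k x := by
  simp only [mFourier, toTorus, ContinuousMap.coe_mk, fourier_coe_apply, fourierChar,
    ← Complex.exp_sum]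
  congr 1
  push_cast
  rw [Finset.mul_sum]
  refine Finset.sum_congr rfl fun i _ => ?_
  ring

lemma fourierChar_cubeRep {m : ℕ} (k : Fin m → ℤ) (y : UnitAddTorus (Fin m)) :
    fourierChar k (cubeRep y) = mFourier k y := by
  rw [← mFourier_toTorus, toTorus_cubeRep]

lemma measurableSet_unitCube (m : ℕ) : MeasurableSet (unitCube m) := by
  have : unitCube m = ⋂ i, (fun x : EuclideanSpace ℝ (Fin m) => x i) ⁻¹' Set.Icc (0 : ℝ) 1 := by
    ext x; simp [unitCube]
  rw [this]
  refine MeasurableSet.iInter fun i => ?_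
  have h : Measurable fun x : EuclideanSpace ℝ (Fin m) => x i := by fun_prop
  exact h measurableSet_Icc

/-- Up to null sets the closed cube may be replaced by `(0,1]^m`, a fundamental domain. -/
lemma measurePreserving_ofLp_unitCube (m : ℕ) :
    MeasurePreserving (WithLp.ofLp : EuclideanSpace ℝ (Fin m) → (Fin m → ℝ))
      (volume.restrict (unitCube m))
      (Measure.pi fun _ => (volume : Measure ℝ).restrict (Set.Ioc (0 : ℝ) (0 + 1))) := by
  have h1 := (PiLp.volume_preserving_ofLp (Fin m)).restrict_preimage
    (MeasurableSet.univ_pi fun _ : Fin m => measurableSet_Icc (a := (0 : ℝ)) (b := 1))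
  have h2 : unitCube m = (WithLp.ofLp : EuclideanSpace ℝ (Fin m) → (Fin m → ℝ)) ⁻¹'
      (Set.univ.pi fun _ => Set.Icc (0 : ℝ) 1) := by
    ext x
    simp only [unitCube, Set.mem_ofPred_eq, Set.mem_preimage, Set.mem_univ_pi]
  have h3 : (volume : Measure (Fin m → ℝ)).restrict (Set.univ.pi fun _ => Set.Icc (0 : ℝ) 1) =
      Measure.pi fun _ => (volume : Measure ℝ).restrict (Set.Ioc (0 : ℝ) (0 + 1)) := by
    rw [volume_pi, Measure.restrict_pi_pi]
    congr 1
    funext i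
    rw [zero_add]
    exact (Measure.restrict_congr_set Ioc_ae_eq_Icc).symm
  rw [h2, ← h3]
  exact h1

lemma measurePreserving_toTorus (m : ℕ) :
    MeasurePreserving (toTorus (m := m)) (volume.restrict (unitCube m)) volume := by
  have h := measurePreserving_pi (ι := Fin m) _ _
    (fun _ => AddCircle.measurePreserving_mk (1 : ℝ) 0)
  have h3 := h.comp (measurePreserving_ofLp_unitCube m)
  have h4 : (volume : Measure (UnitAddTorus (Fin m))) =
      Measure.pi fun _ => (AddCircle.measureSpace (1 : ℝ)).volume := by
    rw [volume_pi]
    congr 1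
    funext i
    change AddCircle.haarAddCircle = _
    rw [AddCircle.volume_eq_smul_haarAddCircle]
    simp
  rw [h4]
  exact h3

lemma cubeRep_toTorus_ae (m : ℕ) :
    ∀ᵐ x ∂(volume.restrict (unitCube m)), cubeRep (toTorus x) = x := by
  have h := (measurePreserving_ofLp_unitCube m).quasiMeasurePreserving.ae
    (p := fun x : Fin m → ℝ => ∀ i, x i ∈ Set.Ioc (0 : ℝ) (0 + 1)) (by
      rw [← Measure.restrict_pi_pi]
      filter_upwards [ae_restrict_mem
        (MeasurableSet.univ_pi fun _ : Fin m => measurableSet_Ioc)] with x hx i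
      exact hx i trivial)
  filter_upwards [h] with x hx
  ext i
  simp only [cubeRep, toTorus]
  exact AddCircle.equivIoc_coe_of_mem (hx i)

lemma measurePreserving_cubeRep (m : ℕ) :
    MeasurePreserving (cubeRep (m := m)) volume (volume.restrict (unitCube m)) := by
  refine ⟨measurable_cubeRep, ?_⟩
  rw [← (measurePreserving_toTorus m).map_eq,
    Measure.map_map measurable_cubeRep measurable_toTorus]
  have : (cubeRep ∘ toTorus) =ᵐ[volume.restrict (unitCube m)] id := cubeRep_toTorus_ae m
  rw [Measure.map_congr this, Measure.map_id]

lemma measurableEmbedding_cubeRep (m : ℕ) : MeasurableEmbedding (cubeRep (m := m)) := by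
  refine MeasurableEmbedding.of_measurable_inverse measurable_cubeRep ?_ measurable_toTorus
    toTorus_cubeRep
  have : Set.range (cubeRep (m := m)) = {x | cubeRep (toTorus x) = x} := by
    ext x
    constructor
    · rintro ⟨y, rfl⟩
      simp [toTorus_cubeRep]
    · intro h
      exact ⟨_, h⟩
  rw [this]
  exact measurableSet_eq_fun (measurable_cubeRep.comp measurable_toTorus) measurable_id

lemma isNegInvariant_volume_torus (m : ℕ) :
    (volume : Measure (UnitAddTorus (Fin m))).IsNegInvariant := by
  have : (volume : Measure UnitAddCircle).IsNegInvariant :=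
    Measure.IsAddHaarMeasure.isNegInvariant_of_regular _
  exact inferInstanceAs
    (Measure.pi fun _ : Fin m => (volume : Measure UnitAddCircle)).IsNegInvariant

lemma setIntegral_unitCube_eq {m : ℕ} {F : Type*} [NormedAddCommGroup F] [NormedSpace ℝ F]
    (q : EuclideanSpace ℝ (Fin m) → F) :
    ∫ x in unitCube m, q x = ∫ y : UnitAddTorus (Fin m), q (cubeRep y) :=
  ((measurePreserving_cubeRep m).integral_comp (measurableEmbedding_cubeRep m) q).symm

/-- The Fourier coefficients on the cube are those of the function transported to the torus, for
which Mathlib has Fourier inversion and Parseval's identity. -/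
lemma cubeCoeff_eq_mFourierCoeff {m : ℕ} (q : EuclideanSpace ℝ (Fin m) → ℝ) (k : Fin m → ℤ) :
    cubeCoeff q k = mFourierCoeff (fun y => (q (cubeRep y) : ℂ)) k := by
  rw [cubeCoeff, setIntegral_unitCube_eq, mFourierCoeff]
  simp only [fourierChar_cubeRep, smul_eq_mul, mul_comm]

lemma memLp_comp_cubeRep {m : ℕ} {q : EuclideanSpace ℝ (Fin m) → ℝ}
    (hq : MemLp q 2 (volume.restrict (unitCube m))) :
    MemLp (fun y => (q (cubeRep y) : ℂ)) 2 (volume : Measure (UnitAddTorus (Fin m))) :=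
  (hq.comp_measurePreserving (measurePreserving_cubeRep m)).ofReal

/-- A square integrable function with absolutely summable Fourier coefficients is, almost
everywhere on the cube, the sum of its Fourier series. -/
lemma ae_eq_tsum_cubeCoeff {m : ℕ} {q : EuclideanSpace ℝ (Fin m) → ℝ}
    (hq : MemLp q 2 (volume.restrict (unitCube m)))
    (hs : Summable fun k : Fin m → ℤ => ‖cubeCoeff q k‖) :
    ∀ᵐ x ∂(volume.restrict (unitCube m)),
      (q x : ℂ) = ∑' k : Fin m → ℤ, cubeCoeff q k * fourierChar k x := by
  have hq' := memLp_comp_cubeRep hq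
  set Q : Lp ℂ 2 (volume : Measure (UnitAddTorus (Fin m))) := hq'.toLp with hQ
  have hcoef : ∀ k, mFourierCoeff Q k = cubeCoeff q k := by
    intro k
    rw [cubeCoeff_eq_mFourierCoeff]
    refine integral_congr_ae ?_
    filter_upwards [hq'.coeFn_toLp] with y hy
    rw [hQ, hy]
  have h1 := hasSum_mFourier_series_L2 Q
  simp only [hcoef] at h1
  have hsum : Summable fun k : Fin m → ℤ => cubeCoeff q k • (mFourier k) := by
    refine .of_norm ?_
    simpa only [norm_smul, mFourier_norm, mul_one] using hs
  -- The series also converges uniformly, hence in `L²`, and the two limits agree.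
  obtain ⟨G, hG⟩ := hsum
  have h2 := (ContinuousMap.toLp (E := ℂ) 2 (volume : Measure (UnitAddTorus (Fin m))) ℂ).hasSum hG
  simp only [map_smul] at h2
  have h3 := h1.unique h2
  have h4 : ∀ᵐ y ∂(volume : Measure (UnitAddTorus (Fin m))), (q (cubeRep y) : ℂ) = G y := by
    filter_upwards [hq'.coeFn_toLp, ContinuousMap.coeFn_toLp (p := 2) (𝕜 := ℂ) volume G] with y hy1 hy2
    rw [← hy1, ← hy2, ← hQ, h3]
  filter_upwards [(measurePreserving_toTorus m).quasiMeasurePreserving.ae h4,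
    cubeRep_toTorus_ae m] with x hx1 hx2
  rw [hx2] at hx1
  rw [hx1]
  have h5 := (ContinuousMap.evalCLM ℂ (toTorus x)).hasSum hG
  simpa [mFourier_toTorus] using h5.tsum_eq.symm

/-- The Fourier series of the convolution of square integrable functions: the coefficients are the
products of the coefficients of the factors, and the series converges everywhere. -/
lemma hasSum_convOp {m : ℕ} {ψ θ : EuclideanSpace ℝ (Fin m) → ℝ} (hψ : IsDistortion ψ)
    (hθ : MemLp θ 2 (volume.restrict (unitCube m))) (x : EuclideanSpace ℝ (Fin m)) :
    HasSum (fun k : Fin m → ℤ => cubeCoeff θ k * cubeCoeff ψ k * fourierChar k x)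
      (convOp ψ θ x : ℂ) := by
  have hθ' := memLp_comp_cubeRep hθ
  have hψ0 := memLp_comp_cubeRep hψ.memLp
  have := isNegInvariant_volume_torus m
  have hψ' : MemLp (fun y => (ψ (cubeRep (toTorus x - y)) : ℂ)) 2
      (volume : Measure (UnitAddTorus (Fin m))) :=
    hψ0.comp_measurePreserving (Measure.measurePreserving_sub_left volume (toTorus x))
  set T : Lp ℂ 2 (volume : Measure (UnitAddTorus (Fin m))) := hθ'.toLp with hT
  set P : Lp ℂ 2 (volume : Measure (UnitAddTorus (Fin m))) := hψ'.toLp with hPdef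
  have hP := hasSum_prod_mFourierCoeff T P
  have hint : ∫ t, (starRingEnd ℂ) (T t) * P t = (convOp ψ θ x : ℂ) := by
    rw [convOp, setIntegral_unitCube_eq, ← integral_complex_ofReal]
    refine integral_congr_ae ?_
    filter_upwards [hθ'.coeFn_toLp, hψ'.coeFn_toLp] with y h1 h2
    rw [h1, h2, Complex.conj_ofReal, ← Complex.ofReal_mul]
    -- `ψ` sees only the class of its argument modulo the lattice.
    obtain ⟨k, hk⟩ := exists_latticePoint_of_toTorus_eq (x := cubeRep (toTorus x - y))
      (y := x - cubeRep y) (by rw [toTorus_cubeRep, toTorus_sub, toTorus_cubeRep])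
    rw [hk, hψ.periodic]
  rw [hint] at hP
  have hc1 : ∀ k, (starRingEnd ℂ) (mFourierCoeff T k) = cubeCoeff θ (-k) := by
    intro k
    rw [cubeCoeff_eq_mFourierCoeff, mFourierCoeff, mFourierCoeff, ← integral_conj]
    refine integral_congr_ae ?_
    filter_upwards [hθ'.coeFn_toLp] with y h1
    rw [hT, h1]
    simp [mFourier_neg]
  have hc2 : ∀ k, mFourierCoeff P k = fourierChar (-k) x * cubeCoeff ψ (-k) := by
    intro k
    rw [cubeCoeff_eq_mFourierCoeff, mFourierCoeff, mFourierCoeff, ← integral_const_mul]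
    refine Eq.trans ?_ (integral_sub_left_eq_self (fun y => fourierChar (-k) x *
      (mFourier (-(-k)) y • (ψ (cubeRep y) : ℂ))) volume (toTorus x))
    refine integral_congr_ae ?_
    filter_upwards [hψ'.coeFn_toLp] with y h1
    rw [hPdef, h1, ← mFourier_toTorus, smul_eq_mul, smul_eq_mul, ← mul_assoc]
    congr 1
    simp only [mFourier, ContinuousMap.coe_mk, ← Finset.prod_mul_distrib]
    refine Finset.prod_congr rfl fun i _ => ?_
    simp only [Pi.neg_apply, Pi.sub_apply, fourier_apply, ← Circle.coe_mul,
      ← AddCircle.toCircle_add]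
    congr 2
    simp only [neg_smul, smul_sub]
    abel
  simp only [hc1, hc2] at hP
  -- Parseval conjugates the coefficients of `θ`; as `θ` is real this replaces `k` by `-k`.
  have hP' := (Equiv.neg (Fin m → ℤ)).hasSum_iff.2 hP
  refine hP'.congr_fun ?_
  intro k
  simp only [Function.comp, Equiv.neg_apply, neg_neg]
  ring

lemma setIntegral_fourierChar {m : ℕ} (k : Fin m → ℤ) :
    ∫ x in unitCube m, fourierChar k x = if k = 0 then 1 else 0 := by
  have h := orthonormal_iff_ite.1 (orthonormal_mFourier (d := Fin m)) 0 k
  rw [ContinuousMap.inner_toLp] at h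
  rw [setIntegral_unitCube_eq]
  simp only [fourierChar_cubeRep]
  simpa [mFourier_zero, eq_comm] using h

lemma isProbabilityMeasure_restrict_unitCube (m : ℕ) : IsProbabilityMeasure
    ((volume : Measure (EuclideanSpace ℝ (Fin m))).restrict (unitCube m)) := by
  rw [← (measurePreserving_cubeRep m).map_eq]
  exact Measure.isProbabilityMeasure_map measurable_cubeRep.aemeasurable

end Torus

/-! ### Lattice frequencies -/

lemma latticePoint_injective {m : ℕ} :
    Function.Injective (latticePoint : (Fin m → ℤ) → EuclideanSpace ℝ (Fin m)) := by
  intro k l h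
  funext i
  have := congrArg (fun x : EuclideanSpace ℝ (Fin m) => x i) h
  simpa [latticePoint] using this

lemma latticePoint_zero {m : ℕ} : latticePoint (0 : Fin m → ℤ) = 0 := by
  ext i
  simp [latticePoint]

lemma latticePoint_add {m : ℕ} (k l : Fin m → ℤ) :
    latticePoint (k + l) = latticePoint k + latticePoint l := by
  ext i
  simp [latticePoint]

lemma latticePoint_neg {m : ℕ} (k : Fin m → ℤ) : latticePoint (-k) = -latticePoint k := by
  ext i
  simp [latticePoint]

lemma latticePoint_eq_zero_iff {m : ℕ} {k : Fin m → ℤ} : latticePoint k = 0 ↔ k = 0 := by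
  rw [← latticePoint_zero, latticePoint_injective.eq_iff]

lemma one_le_norm_latticePoint {m : ℕ} {k : Fin m → ℤ} (hk : k ≠ 0) : 1 ≤ ‖latticePoint k‖ := by
  obtain ⟨i, hi⟩ := Function.ne_iff.1 hk
  refine le_trans ?_ (PiLp.norm_apply_le (latticePoint k) i)
  simp only [latticePoint, Real.norm_eq_abs]
  exact_mod_cast Int.one_le_abs hi

lemma summable_two_add_norm_latticePoint (m : ℕ) :
    Summable fun k : Fin m → ℤ => (2 + ‖latticePoint k‖ : ℝ) ^ (-((m : ℝ) + 2)) := by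
  let b := (EuclideanSpace.basisFun (Fin m) ℝ).toBasis
  let L := Submodule.span ℤ (Set.range b)
  have hmem : ∀ k : Fin m → ℤ, latticePoint k ∈ L := by
    intro k
    have : latticePoint k = ∑ i, k i • b i := by
      ext j
      simp [latticePoint, b, Pi.single_apply]
    rw [this]
    exact Submodule.sum_mem _ fun i _ =>
      Submodule.smul_mem _ _ (Submodule.subset_span (Set.mem_range_self i))
  have hinj : Function.Injective fun k : Fin m → ℤ => (⟨latticePoint k, hmem k⟩ : L) := by
    intro k l h
    exact latticePoint_injective (congrArg Subtype.val h)
  have hrank : Module.finrank ℤ L = m := by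
    rw [ZLattice.rank ℝ L]
    simp
  have hs := (ZLattice.summable_norm_rpow L (-((m : ℝ) + 2)) (by
    rw [hrank]; linarith)).comp_injective hinj
  refine Summable.of_norm_bounded_eventually hs ?_
  have h0 : ({0}ᶜ : Set (Fin m → ℤ)) ∈ cofinite := by simp
  filter_upwards [h0] with k hk
  have hk' : latticePoint k ≠ 0 := fun h => hk (latticePoint_eq_zero_iff.1 h)
  have hpos : 0 < ‖latticePoint k‖ := norm_pos_iff.2 hk'
  rw [Real.norm_of_nonneg (by positivity)]
  exact Real.rpow_le_rpow_of_nonpos hpos (le_add_of_nonneg_left zero_le_two) (by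
    have : (0 : ℝ) ≤ m := Nat.cast_nonneg m
    linarith)

/-! ### An almost sure maximal bound for triangular arrays -/

section Concentration

variable {Ω : Type*} [MeasurableSpace Ω] {μ : Measure Ω} [IsProbabilityMeasure μ]

/-- The bound `exp x ≤ 1 + x + x²` for `|x| ≤ 1`, integrated. -/
lemma mgf_le_exp_of_abs_le {ζ : Ω → ℝ} {s V : ℝ} (hm : Measurable ζ)
    (hb : ∀ ω, |s * ζ ω| ≤ 1) (h0 : ∫ ω, ζ ω ∂μ = 0) (hV : ∫ ω, ζ ω ^ 2 ∂μ ≤ V) :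
    mgf ζ μ s ≤ Real.exp (s ^ 2 * V) := by
  have hm' : Measurable fun ω => s * ζ ω := hm.const_mul s
  have i1 : Integrable (fun ω => s * ζ ω) μ :=
    Integrable.of_bound hm'.aestronglyMeasurable 1 (Eventually.of_forall hb)
  have i2 : Integrable (fun ω => (s * ζ ω) ^ 2) μ :=
    Integrable.of_bound (hm'.pow_const 2).aestronglyMeasurable 1 (Eventually.of_forall fun ω => by
      rw [Real.norm_eq_abs, abs_pow]
      exact pow_le_one₀ (abs_nonneg _) (hb ω))
  have h1 : mgf ζ μ s ≤ ∫ ω, (1 + s * ζ ω + (s * ζ ω) ^ 2) ∂μ := by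
    refine integral_mono_of_nonneg (Eventually.of_forall fun ω => (Real.exp_pos _).le)
      (((integrable_const 1).add i1).add i2) (Eventually.of_forall fun ω => ?_)
    have := (abs_le.1 (Real.abs_exp_sub_one_sub_id_le (hb ω))).2
    change Real.exp (s * ζ ω) ≤ _
    linarith
  have h2 : ∫ ω, (1 + s * ζ ω + (s * ζ ω) ^ 2) ∂μ = 1 + s ^ 2 * ∫ ω, ζ ω ^ 2 ∂μ := by
    have i3 : Integrable (fun ω => 1 + s * ζ ω) μ := (integrable_const 1).add i1
    rw [integral_add i3 i2, integral_add (integrable_const 1) i1]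
    simp_rw [mul_pow, integral_const_mul, h0]
    simp
  rw [h2] at h1
  have h3 : s ^ 2 * ∫ ω, ζ ω ^ 2 ∂μ ≤ s ^ 2 * V := by gcongr
  linarith [Real.add_one_le_exp (s ^ 2 * V)]

lemma measureReal_le_sum_le {ζ : ℕ → Ω → ℝ} {n : ℕ} (hn : 1 ≤ n) {B : ℝ} (hB : 0 < B)
    (hm : ∀ i, Measurable (ζ i)) (hi : iIndepFun ζ μ)
    (hb : ∀ i < n, ∀ ω, |ζ i ω| ≤ B * √n) (h0 : ∀ i < n, ∫ ω, ζ i ω ∂μ = 0)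
    (hV : ∀ i < n, ∫ ω, ζ i ω ^ 2 ∂μ ≤ B ^ 2) (t : ℝ) :
    μ.real {ω | t ≤ ∑ i ∈ Finset.range n, ζ i ω} ≤ Real.exp (1 - t / (B * √n)) := by
  have hn' : (0 : ℝ) < n := by exact_mod_cast hn
  have hD : 0 < B * √n := by positivity
  -- The largest parameter for which `s * ζ i` stays in `[-1, 1]`; then `n s² B² = 1`.
  set s : ℝ := 1 / (B * √n) with hs
  have hmgf : mgf (∑ i ∈ Finset.range n, ζ i) μ s ≤ Real.exp 1 := by
    rw [hi.mgf_sum hm]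
    calc ∏ i ∈ Finset.range n, mgf (ζ i) μ s
        ≤ ∏ i ∈ Finset.range n, Real.exp (s ^ 2 * B ^ 2) := by
          refine Finset.prod_le_prod (fun i _ => mgf_nonneg) fun i hin => ?_
          have hin' := Finset.mem_range.1 hin
          refine mgf_le_exp_of_abs_le (hm i) (fun ω => ?_) (h0 i hin') (hV i hin')
          rw [abs_mul, abs_of_pos (by positivity), hs, one_div, inv_mul_le_iff₀ hD, mul_one]
          exact hb i hin' ω
      _ = Real.exp 1 := by
          rw [Finset.prod_const, Finset.card_range, ← Real.exp_nat_mul]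
          congr 1
          rw [hs, one_div, inv_pow, mul_pow, Real.sq_sqrt hn'.le]
          field_simp
  have hbd : ∀ ω, |∑ i ∈ Finset.range n, ζ i ω| ≤ n * (B * √n) := by
    intro ω
    refine (Finset.abs_sum_le_sum_abs _ _).trans ?_
    refine (Finset.sum_le_card_nsmul _ _ (B * √n) fun i hin =>
      hb i (Finset.mem_range.1 hin) ω).trans ?_
    simp
  have hmeas : Measurable (∑ i ∈ Finset.range n, ζ i) := by
    have := Finset.measurable_sum (Finset.range n) fun i _ => hm i
    convert this using 1
    ext ω
    simp
  have hint : Integrable (fun ω => Real.exp (s * (∑ i ∈ Finset.range n, ζ i) ω)) μ := by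
    refine Integrable.of_bound (hmeas.const_mul s).exp.aestronglyMeasurable
      (Real.exp (s * (n * (B * √n)))) (Eventually.of_forall fun ω => ?_)
    rw [Real.norm_of_nonneg (Real.exp_pos _).le]
    gcongr
    rw [Finset.sum_apply]
    exact (abs_le.1 (hbd ω)).2
  have h1 := measure_ge_le_exp_mul_mgf (μ := μ) (X := ∑ i ∈ Finset.range n, ζ i) t
    (by positivity : 0 ≤ s) hint
  simp only [Finset.sum_apply] at h1
  refine h1.trans ?_
  calc Real.exp (-s * t) * mgf (∑ i ∈ Finset.range n, ζ i) μ s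
      ≤ Real.exp (-s * t) * Real.exp 1 := by gcongr
    _ = Real.exp (1 - t / (B * √n)) := by
      rw [← Real.exp_add]
      congr 1
      rw [hs]
      ring

/-- A Bernstein-type inequality. The exponent is only linear in `t`, which is all that the
logarithmic bounds below need; in exchange the summands may be as large as `B √n`. -/
lemma measureReal_le_abs_sum_le {ζ : ℕ → Ω → ℝ} {n : ℕ} (hn : 1 ≤ n) {B : ℝ} (hB : 0 < B)
    (hm : ∀ i, Measurable (ζ i)) (hi : iIndepFun ζ μ)
    (hb : ∀ i < n, ∀ ω, |ζ i ω| ≤ B * √n) (h0 : ∀ i < n, ∫ ω, ζ i ω ∂μ = 0)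
    (hV : ∀ i < n, ∫ ω, ζ i ω ^ 2 ∂μ ≤ B ^ 2) (t : ℝ) :
    μ.real {ω | t ≤ |∑ i ∈ Finset.range n, ζ i ω|} ≤ 2 * Real.exp (1 - t / (B * √n)) := by
  have h1 := measureReal_le_sum_le hn hB hm hi hb h0 hV t
  have h2 := measureReal_le_sum_le (ζ := fun i ω => -ζ i ω) hn hB (fun i => (hm i).neg)
    (hi.comp (fun _ x => -x) fun _ => measurable_neg)
    (fun i hin ω => by rw [abs_neg]; exact hb i hin ω)
    (fun i hin => by rw [integral_neg, h0 i hin, neg_zero])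
    (fun i hin => by simpa using hV i hin) t
  have h3 : {ω | t ≤ |∑ i ∈ Finset.range n, ζ i ω|} ⊆
      {ω | t ≤ ∑ i ∈ Finset.range n, ζ i ω} ∪ {ω | t ≤ ∑ i ∈ Finset.range n, -ζ i ω} := by
    intro ω hω
    simp only [Set.mem_ofPred_eq, Set.mem_union, Finset.sum_neg_distrib] at hω ⊢
    exact le_abs.1 hω
  have h4 := (measureReal_mono h3 (μ := μ)).trans (measureReal_union_le _ _)
  linarith

/-- Almost surely, the row sums of a triangular array of independent centred variables, indexed
in addition by the lattice `ℤ^m`, are at most of order `√n (log n + log (2 + ‖k‖))`, uniformly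
in `k`. The logarithm of `‖k‖` makes the exceptional probabilities summable over the lattice. -/
lemma ae_eventually_forall_abs_sum_le {m : ℕ} {ζ : ℕ → (Fin m → ℤ) → ℕ → Ω → ℝ} {B : ℝ}
    (hB : 0 < B) (N : ℕ) (hm : ∀ n k i, Measurable (ζ n k i)) (hi : ∀ n k, iIndepFun (ζ n k) μ)
    (hb : ∀ n ≥ N, ∀ k, ∀ i < n, ∀ ω, |ζ n k i ω| ≤ B * √n)
    (h0 : ∀ n ≥ N, ∀ k, ∀ i < n, ∫ ω, ζ n k i ω ∂μ = 0)
    (hV : ∀ n ≥ N, ∀ k, ∀ i < n, ∫ ω, ζ n k i ω ^ 2 ∂μ ≤ B ^ 2) :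
    ∀ᵐ ω ∂μ, ∀ᶠ n : ℕ in atTop, ∀ k : Fin m → ℤ, |∑ i ∈ Finset.range n, ζ n k i ω| ≤
      B * √n * ((m + 2) * (Real.log n + Real.log (2 + ‖latticePoint k‖))) := by
  set T : ℕ → (Fin m → ℤ) → ℝ := fun n k =>
    B * √n * ((m + 2) * (Real.log n + Real.log (2 + ‖latticePoint k‖))) with hT
  set S : ℕ × (Fin m → ℤ) → Set Ω := fun p =>
    {ω | max N 1 ≤ p.1 ∧ T p.1 p.2 ≤ |∑ i ∈ Finset.range p.1, ζ p.1 p.2 i ω|} with hS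
  set u : ℕ × (Fin m → ℤ) → ℝ := fun p => (2 * Real.exp 1) *
    ((p.1 : ℝ) ^ (-((m : ℝ) + 2)) * (2 + ‖latticePoint p.2‖ : ℝ) ^ (-((m : ℝ) + 2))) with hu
  have hus : Summable u := by
    refine Summable.mul_left _ (Summable.mul_of_nonneg (Real.summable_nat_rpow.2 ?_)
      (summable_two_add_norm_latticePoint m) (fun n => by positivity) (fun k => by positivity))
    have : (0 : ℝ) ≤ m := Nat.cast_nonneg m
    linarith
  have hle : ∀ p, μ (S p) ≤ ENNReal.ofReal (u p) := by
    rintro ⟨n, k⟩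
    by_cases hn : max N 1 ≤ n
    · have hn1 : 1 ≤ n := (le_max_right _ _).trans hn
      have hnN : n ≥ N := (le_max_left _ _).trans hn
      have hn' : (0 : ℝ) < n := by exact_mod_cast hn1
      have h1 := measureReal_le_abs_sum_le hn1 hB (hm n k) (hi n k) (hb n hnN k) (h0 n hnN k)
        (hV n hnN k) (T n k)
      have h2 : 2 * Real.exp (1 - T n k / (B * √n)) = u (n, k) := by
        have hk : (0 : ℝ) < 2 + ‖latticePoint k‖ := by positivity
        have h3 : T n k / (B * √n) =
            (m + 2) * (Real.log n + Real.log (2 + ‖latticePoint k‖)) := by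
          simp only [hT]
          field_simp
        rw [h3]
        simp only [hu, Real.rpow_def_of_pos hn', Real.rpow_def_of_pos hk]
        rw [← Real.exp_add, mul_assoc, ← Real.exp_add]
        congr 2
        ring
      rw [h2] at h1
      have h5 : S (n, k) = {ω | T n k ≤ |∑ i ∈ Finset.range n, ζ n k i ω|} := by
        ext ω
        simp only [hS, Set.mem_ofPred_eq, hn, true_and]
      rw [h5, ← ofReal_measureReal]
      exact ENNReal.ofReal_le_ofReal h1
    · have : S (n, k) = ∅ := by
        ext ω
        simp only [hS, Set.mem_ofPred_eq, hn, false_and, Set.mem_empty_iff_false]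
      rw [this]
      simp
  have hfin : ∑' p, μ (S p) ≠ ⊤ := by
    refine ne_top_of_le_ne_top ?_ (ENNReal.tsum_le_tsum hle)
    exact hus.tsum_ofReal_ne_top
  filter_upwards [ae_finite_setOfPred_mem hfin] with ω hω
  -- By Borel–Cantelli over pairs `(n, k)`, only finitely many pairs are exceptional.
  have h6 : (Prod.fst '' {p | ω ∈ S p}).Finite := hω.image _
  obtain ⟨M, hM⟩ := h6.bddAbove
  filter_upwards [eventually_gt_atTop M, eventually_ge_atTop (max N 1)] with n hn hnN k
  by_contra hcon
  have : n ≤ M := hM ⟨(n, k), ⟨hnN, (not_le.1 hcon).le⟩, rfl⟩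
  omega


/-- The complex-valued version of `ae_eventually_forall_abs_sum_le`. -/
lemma ae_eventually_forall_norm_sum_le {m : ℕ} {z : ℕ → (Fin m → ℤ) → ℕ → Ω → ℂ} {B : ℝ}
    (hB : 0 < B) (N : ℕ) (hm : ∀ n k i, Measurable (z n k i)) (hi : ∀ n k, iIndepFun (z n k) μ)
    (hb : ∀ n ≥ N, ∀ k, ∀ i < n, ∀ ω, ‖z n k i ω‖ ≤ B * √n)
    (h0 : ∀ n ≥ N, ∀ k, ∀ i < n, ∫ ω, z n k i ω ∂μ = 0)
    (hV : ∀ n ≥ N, ∀ k, ∀ i < n, ∫ ω, ‖z n k i ω‖ ^ 2 ∂μ ≤ B ^ 2) :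
    ∀ᵐ ω ∂μ, ∀ᶠ n : ℕ in atTop, ∀ k : Fin m → ℤ, ‖∑ i ∈ Finset.range n, z n k i ω‖ ≤
      2 * B * (m + 2) * (√n * (Real.log n + Real.log (2 + ‖latticePoint k‖))) := by
  have hint : ∀ n ≥ N, ∀ k, ∀ i < n, Integrable (z n k i) μ := fun n hn k i hin =>
    Integrable.of_bound (hm n k i).aestronglyMeasurable _ (Eventually.of_forall (hb n hn k i hin))
  have hint2 : ∀ n ≥ N, ∀ k, ∀ i < n, Integrable (fun ω => ‖z n k i ω‖ ^ 2) μ := by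
    intro n hn k i hin
    refine Integrable.of_bound ((hm n k i).norm.pow_const 2).aestronglyMeasurable ((B * √n) ^ 2)
      (Eventually.of_forall fun ω => ?_)
    rw [Real.norm_of_nonneg (by positivity)]
    gcongr
    exact hb n hn k i hin ω
  have hre := ae_eventually_forall_abs_sum_le (ζ := fun n k i ω => (z n k i ω).re) hB N
    (fun n k i => Complex.measurable_re.comp (hm n k i))
    (fun n k => (hi n k).comp (fun _ => Complex.re) fun _ => Complex.measurable_re)
    (fun n hn k i hin ω => (Complex.abs_re_le_norm _).trans (hb n hn k i hin ω))
    (fun n hn k i hin => by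
      have h1 := integral_re (𝕜 := ℂ) (hint n hn k i hin)
      rw [h0 n hn k i hin] at h1
      simpa using h1)
    (fun n hn k i hin => by
      refine (integral_mono_of_nonneg (Eventually.of_forall fun ω => sq_nonneg _)
        (hint2 n hn k i hin) (Eventually.of_forall fun ω => ?_)).trans (hV n hn k i hin)
      change (z n k i ω).re ^ 2 ≤ ‖z n k i ω‖ ^ 2
      rw [← sq_abs]
      gcongr
      exact Complex.abs_re_le_norm _)
  have him := ae_eventually_forall_abs_sum_le (ζ := fun n k i ω => (z n k i ω).im) hB N
    (fun n k i => Complex.measurable_im.comp (hm n k i))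
    (fun n k => (hi n k).comp (fun _ => Complex.im) fun _ => Complex.measurable_im)
    (fun n hn k i hin ω => (Complex.abs_im_le_norm _).trans (hb n hn k i hin ω))
    (fun n hn k i hin => by
      have h1 := integral_im (𝕜 := ℂ) (hint n hn k i hin)
      rw [h0 n hn k i hin] at h1
      simpa using h1)
    (fun n hn k i hin => by
      refine (integral_mono_of_nonneg (Eventually.of_forall fun ω => sq_nonneg _)
        (hint2 n hn k i hin) (Eventually.of_forall fun ω => ?_)).trans (hV n hn k i hin)
      change (z n k i ω).im ^ 2 ≤ ‖z n k i ω‖ ^ 2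
      rw [← sq_abs]
      gcongr
      exact Complex.abs_im_le_norm _)
  filter_upwards [hre, him] with ω h1 h2
  filter_upwards [h1, h2] with n h1 h2 k
  have h3 := Complex.norm_le_abs_re_add_abs_im (∑ i ∈ Finset.range n, z n k i ω)
  rw [Complex.re_sum, Complex.im_sum] at h3
  linarith [h1 k, h2 k]

/-! ### Empirical Fourier coefficients -/

lemma norm_fourierChar {m : ℕ} (k : Fin m → ℤ) (x : EuclideanSpace ℝ (Fin m)) :
    ‖fourierChar k x‖ = 1 := by
  rw [fourierChar, show Complex.I * 2 * Real.pi * ((∑ i, (k i : ℝ) * x i : ℝ) : ℂ) =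
    ((2 * Real.pi * (∑ i, (k i : ℝ) * x i) : ℝ) : ℂ) * Complex.I by push_cast; ring]
  exact Complex.norm_exp_ofReal_mul_I _

lemma continuous_fourierChar {m : ℕ} (k : Fin m → ℤ) :
    Continuous (fourierChar k : EuclideanSpace ℝ (Fin m) → ℂ) := by
  unfold fourierChar
  fun_prop

/-- The empirical Fourier coefficients of a bounded function converge at the rate `n^{-1/2}`, up to
logarithms, uniformly over all frequencies. -/
lemma ae_empiricalCoeff_sub_integral_le {m : ℕ} {X : ℕ → Ω → EuclideanSpace ℝ (Fin m)}
    (hX_meas : ∀ j, Measurable (X j)) (hX_indep : iIndepFun X μ)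
    (hX_ident : ∀ j, IdentDistrib (X j) (X 0) μ μ)
    {h : EuclideanSpace ℝ (Fin m) → ℝ} (hh : Measurable h) {H : ℝ} (hH : ∀ x, |h x| ≤ H) :
    ∀ᵐ ω ∂μ, ∃ C : ℝ, ∀ᶠ n : ℕ in atTop, ∀ k : Fin m → ℤ,
      ‖∑ i ∈ Finset.range n, ((h (X i ω) : ℂ) * fourierChar (-k) (X i ω) -
          ∫ ω, (h (X 0 ω) : ℂ) * fourierChar (-k) (X 0 ω) ∂μ)‖ ≤
        C * (√n * (Real.log n + Real.log (2 + ‖latticePoint k‖))) := by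
  have hH0 : 0 ≤ H := (abs_nonneg _).trans (hH 0)
  set φ : (Fin m → ℤ) → EuclideanSpace ℝ (Fin m) → ℂ := fun k x =>
    (h x : ℂ) * fourierChar (-k) x with hφ
  have hφm : ∀ k, Measurable (φ k) := fun k =>
    (Complex.measurable_ofReal.comp hh).mul (continuous_fourierChar _).measurable
  have hφb : ∀ k x, ‖φ k x‖ ≤ H := by
    intro k x
    simp only [hφ, norm_mul, norm_fourierChar, mul_one, Complex.norm_real, Real.norm_eq_abs]
    exact hH x
  have hφi : ∀ k i, Integrable (fun ω => φ k (X i ω)) μ := fun k i =>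
    Integrable.of_bound ((hφm k).comp (hX_meas i)).aestronglyMeasurable H
      (Eventually.of_forall fun ω => hφb k _)
  set E : (Fin m → ℤ) → ℂ := fun k => ∫ ω, φ k (X 0 ω) ∂μ with hE
  have hEb : ∀ k, ‖E k‖ ≤ H := by
    intro k
    have := norm_integral_le_of_norm_le_const (μ := μ)
      (Eventually.of_forall fun ω => hφb k (X 0 ω))
    simpa using this
  have hEi : ∀ k i, ∫ ω, φ k (X i ω) ∂μ = E k := fun k i =>
    ((hX_ident i).comp (hφm k)).integral_eq
  have hzb : ∀ k i ω, ‖φ k (X i ω) - E k‖ ≤ 2 * H + 1 := fun k i ω =>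
    (norm_sub_le _ _).trans (by linarith [hφb k (X i ω), hEb k])
  have := ae_eventually_forall_norm_sum_le (μ := μ)
    (z := fun _ k i ω => φ k (X i ω) - E k) (B := 2 * H + 1) (by linarith) 0
    (fun n k i => ((hφm k).comp (hX_meas i)).sub_const _)
    (fun n k => hX_indep.comp (fun _ x => φ k x - E k) fun _ => (hφm k).sub_const _)
    (fun n _ k i hin ω => (hzb k i ω).trans (by
      have : (1 : ℝ) ≤ √n := by
        rw [Real.one_le_sqrt]
        exact_mod_cast (by omega : 1 ≤ n)
      nlinarith))
    (fun n _ k i hin => by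
      rw [integral_sub (hφi k i) (integrable_const _), hEi]
      simp)
    (fun n _ k i hin => by
      have h1 := norm_integral_le_of_norm_le_const (μ := μ) (C := (2 * H + 1) ^ 2)
        (f := fun ω => ‖φ k (X i ω) - E k‖ ^ 2) (Eventually.of_forall fun ω => by
          rw [Real.norm_of_nonneg (by positivity)]
          gcongr
          exact hzb k i ω)
      rw [probReal_univ, mul_one] at h1
      exact (le_abs_self _).trans h1)
  filter_upwards [this] with ω hω
  exact ⟨_, hω⟩

/-! ### Weighted sums of the errors -/

lemma abs_truncation_sub_le {α : Type*} (f : α → ℝ) {A : ℝ} (hA : 0 < A) (x : α) :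
    |truncation f A x - f x| ≤ f x ^ 2 / A := by
  rcases lt_or_ge |f x| A with h | h
  · rw [truncation_eq_self h, sub_self, abs_zero]
    positivity
  · have h1 : |truncation f A x - f x| ≤ |f x| := by
      simp only [truncation, Function.comp, Set.indicator]
      split_ifs <;> simp
    refine h1.trans ?_
    rw [le_div_iff₀ hA, ← sq_abs, sq]
    gcongr

lemma sum_inv_sqrt_le (n : ℕ) : ∑ i ∈ Finset.range n, 1 / √((i : ℝ) + 1) ≤ 2 * √n := by
  induction n with
  | zero => simp
  | succ n ih =>
    rw [Finset.sum_range_succ]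
    have h1 : 0 < √((n : ℝ) + 1) := Real.sqrt_pos.2 (by positivity)
    have h2 : √((n : ℝ) + 1) ^ 2 = n + 1 := Real.sq_sqrt (by positivity)
    have h3 : √(n : ℝ) ^ 2 = n := Real.sq_sqrt (by positivity)
    have h5 : 1 / √((n : ℝ) + 1) ≤ 2 * √((n : ℝ) + 1) - 2 * √(n : ℝ) := by
      rw [div_le_iff₀ h1]
      nlinarith [sq_nonneg (√((n : ℝ) + 1) - √(n : ℝ))]
    push_cast
    linarith

/-- Truncating the `i`-th error at `√(i+1)` changes only finitely many errors, because the errors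
have a second moment. -/
lemma ae_summable_truncation_sub {ε : ℕ → Ω → ℝ}
    (hε_ident : ∀ j, IdentDistrib (ε j) (ε 0) μ μ) (h2 : MemLp (ε 0) 2 μ) :
    ∀ᵐ ω ∂μ, Summable fun i : ℕ => |truncation (ε i) (√((i : ℝ) + 1)) ω - ε i ω| := by
  let _ : MeasureSpace Ω := ⟨μ⟩
  have hint : Integrable (fun ω => ε 0 ω ^ 2) μ := h2.integrable_sq
  have h3 := tsum_prob_mem_Ioi_lt_top (Ω := Ω) (X := fun ω => ε 0 ω ^ 2) hint
    (fun ω => sq_nonneg _)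
  have h4 : ∑' j : ℕ, μ {ω | ε j ω ^ 2 ∈ Set.Ioi (j : ℝ)} ≠ ⊤ := by
    refine ne_of_lt (lt_of_eq_of_lt ?_ h3)
    refine tsum_congr fun j => ?_
    exact ((hε_ident j).comp (measurable_id.pow_const 2)).measure_mem_eq measurableSet_Ioi
  filter_upwards [ae_eventually_notMem h4] with ω hω
  obtain ⟨N, hN⟩ := eventually_atTop.1 hω
  refine summable_of_ne_finset_zero (s := Finset.range N) fun i hi => ?_
  have h5 := hN i (by simpa using hi)
  simp only [Set.mem_Ioi, not_lt] at h5
  rw [truncation_eq_self, sub_self, abs_zero]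
  rw [← Real.sqrt_sq_eq_abs]
  exact Real.sqrt_lt_sqrt (sq_nonneg _) (by linarith)

/-- Weighted sums of the errors, with a bounded triangular array of deterministic weights. -/
lemma ae_eventually_norm_weighted_sum_le {m : ℕ} {ε : ℕ → Ω → ℝ} (hε_meas : ∀ j, Measurable (ε j))
    (hε_indep : iIndepFun ε μ) (hε_ident : ∀ j, IdentDistrib (ε j) (ε 0) μ μ)
    (hε_mean : ∫ ω, ε 0 ω ∂μ = 0) (h2 : MemLp (ε 0) 2 μ)
    (a : ℕ → (Fin m → ℤ) → ℕ → ℂ) {A : ℝ} (N : ℕ) (ha : ∀ n ≥ N, ∀ k, ∀ i < n, ‖a n k i‖ ≤ A) :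
    ∀ᵐ ω ∂μ, ∃ C : ℕ, ∀ᶠ n : ℕ in atTop, ∀ k : Fin m → ℤ,
      ‖∑ i ∈ Finset.range n, a n k i * (ε i ω : ℂ)‖ ≤
        C * (√n * (Real.log n + Real.log (2 + ‖latticePoint k‖))) := by
  wlog hA : 0 < A generalizing A
  · exact this (A := 1) (fun n hn k i hin => (ha n hn k i hin).trans (by linarith)) one_pos
  have hint : Integrable (fun ω => ε 0 ω ^ 2) μ := h2.integrable_sq
  have hint1 : Integrable (ε 0) μ := h2.integrable one_le_two
  set V : ℝ := ∫ ω, ε 0 ω ^ 2 ∂μ with hVdef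
  have hV0 : 0 ≤ V := integral_nonneg fun ω => sq_nonneg _
  have hsq : ∀ i, IdentDistrib (fun ω => ε i ω ^ 2) (fun ω => ε 0 ω ^ 2) μ μ := fun i =>
    (hε_ident i).comp (measurable_id.pow_const 2)
  have hVi : ∀ i, ∫ ω, ε i ω ^ 2 ∂μ = V := fun i => (hsq i).integral_eq
  have hVint : ∀ i, Integrable (fun ω => ε i ω ^ 2) μ := fun i => (hsq i).integrable_iff.2 hint
  have hεint : ∀ i, Integrable (ε i) μ := fun i => (hε_ident i).integrable_iff.2 hint1
  have hεmean : ∀ i, ∫ ω, ε i ω ∂μ = 0 := fun i => by rw [(hε_ident i).integral_eq, hε_mean]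
  -- `tr i` truncates at `√(i+1)`: large enough to alter only finitely many errors, small enough
  -- for the exponential inequality, and with means `c i` that sum up to `O(√n)`.
  set tr : ℕ → ℝ → ℝ := fun i => Set.indicator (Set.Ioc (-√((i : ℝ) + 1)) √((i : ℝ) + 1)) id
    with htr
  have htrm : ∀ i, Measurable (tr i) := fun i => measurable_id.indicator measurableSet_Ioc
  have htr' : ∀ i ω, tr i (ε i ω) = truncation (ε i) (√((i : ℝ) + 1)) ω := fun i ω => rfl
  have hsp : ∀ i : ℕ, 0 < √((i : ℝ) + 1) := fun i => Real.sqrt_pos.2 (by positivity)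
  have htrb : ∀ i ω, |tr i (ε i ω)| ≤ √((i : ℝ) + 1) := fun i ω => by
    rw [htr']
    exact (abs_truncation_le_bound _ _ _).trans_eq (abs_of_pos (hsp i))
  have htri : ∀ i, Integrable (fun ω => tr i (ε i ω)) μ := fun i =>
    (hε_meas i).aestronglyMeasurable.integrable_truncation
  set c : ℕ → ℝ := fun i => ∫ ω, tr i (ε i ω) ∂μ with hc
  have hcb : ∀ i, |c i| ≤ √((i : ℝ) + 1) := fun i => by
    have := norm_integral_le_of_norm_le_const (μ := μ) (f := fun ω => tr i (ε i ω))
      (Eventually.of_forall (htrb i))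
    simpa using this
  have hcb2 : ∀ i, |c i| ≤ V * (1 / √((i : ℝ) + 1)) := fun i => by
    have h1 : c i = ∫ ω, (tr i (ε i ω) - ε i ω) ∂μ := by
      rw [integral_sub (htri i) (hεint i), hεmean, sub_zero]
    rw [h1, ← hVi i, mul_one_div, ← integral_div]
    refine (abs_integral_le_integral_abs).trans (integral_mono_of_nonneg
      (Eventually.of_forall fun ω => abs_nonneg _) ((hVint i).div_const _)
      (Eventually.of_forall fun ω => ?_))
    exact abs_truncation_sub_le (ε i) (hsp i) ω
  set B : ℝ := A * (2 + V) with hB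
  have hBpos : 0 < B := by positivity
  have hmain := ae_eventually_forall_norm_sum_le (μ := μ)
    (z := fun n k i ω => a n k i * ((tr i (ε i ω) - c i : ℝ) : ℂ)) hBpos N
    (fun n k i => (Complex.measurable_ofReal.comp
      (((htrm i).comp (hε_meas i)).sub_const _)).const_mul _)
    (fun n k => hε_indep.comp (fun i x => a n k i * ((tr i x - c i : ℝ) : ℂ)) fun i =>
      (Complex.measurable_ofReal.comp ((htrm i).sub_const _)).const_mul _)
    (fun n hn k i hin ω => by
      rw [norm_mul, Complex.norm_real, Real.norm_eq_abs]
      have h1 : |tr i (ε i ω) - c i| ≤ (2 + V) * √n := by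
        have h3 : √((i : ℝ) + 1) ≤ √n := Real.sqrt_le_sqrt (by exact_mod_cast hin)
        have h4 : 0 ≤ V * √n := by positivity
        refine (abs_sub _ _).trans ?_
        linarith [htrb i ω, hcb i]
      rw [hB, mul_assoc]
      exact mul_le_mul (ha n hn k i hin) h1 (abs_nonneg _) hA.le)
    (fun n hn k i hin => by
      rw [integral_const_mul, integral_complex_ofReal, integral_sub (htri i) (integrable_const _)]
      simp [hc])
    (fun n hn k i hin => by
      have h1 : ∀ ω, ‖a n k i * ((tr i (ε i ω) - c i : ℝ) : ℂ)‖ ^ 2 =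
          ‖a n k i‖ ^ 2 * (tr i (ε i ω) - c i) ^ 2 := fun ω => by
        rw [norm_mul, mul_pow, Complex.norm_real, Real.norm_eq_abs, sq_abs]
      simp_rw [h1]
      rw [integral_const_mul, hB, mul_pow]
      have h3 : ∫ ω, (tr i (ε i ω) - c i) ^ 2 ∂μ ≤ V := by
        have h4 : AEMeasurable (fun ω => tr i (ε i ω)) μ :=
          ((htrm i).comp (hε_meas i)).aemeasurable
        have h5 := variance_eq_integral h4
        rw [← show c i = ∫ ω, tr i (ε i ω) ∂μ from rfl] at h5
        rw [← h5]
        refine (variance_le_expectation_sq h4.aestronglyMeasurable).trans ?_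
        rw [← hVi i]
        refine integral_mono_of_nonneg (Eventually.of_forall fun ω => sq_nonneg _) (hVint i)
          (Eventually.of_forall fun ω => ?_)
        exact sq_le_sq.2 (abs_truncation_le_abs_self (ε i) _ ω)
      have h6 : ‖a n k i‖ ^ 2 ≤ A ^ 2 := by
        gcongr
        exact ha n hn k i hin
      refine mul_le_mul h6 (h3.trans (by nlinarith)) (integral_nonneg fun ω => sq_nonneg _)
        (by positivity))
  filter_upwards [hmain, ae_summable_truncation_sub hε_ident h2] with ω hω hsum
  set K : ℝ := ∑' i : ℕ, |truncation (ε i) (√((i : ℝ) + 1)) ω - ε i ω| with hK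
  have hK0 : 0 ≤ K := tsum_nonneg fun i => abs_nonneg _
  refine ⟨⌈2 * B * (m + 2) + A * (2 * V) + A * K⌉₊, ?_⟩
  filter_upwards [hω, eventually_ge_atTop N, eventually_ge_atTop 3] with n hn hnN hn3 k
  have hn3' : (3 : ℝ) ≤ n := by exact_mod_cast hn3
  have hs1 : 1 ≤ √(n : ℝ) := by rw [Real.one_le_sqrt]; linarith
  have hl1 : 1 ≤ Real.log n := by
    rw [Real.le_log_iff_exp_le (by linarith)]
    linarith [Real.exp_one_lt_d9]
  have hl2 : 0 ≤ Real.log (2 + ‖latticePoint k‖) :=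
    Real.log_nonneg (by linarith [norm_nonneg (latticePoint k)])
  set L : ℝ := Real.log n + Real.log (2 + ‖latticePoint k‖) with hL
  have hL1 : 1 ≤ L := by linarith
  -- Truncated and centred part, means of the truncated errors, truncation remainders.
  have hsplit : ∑ i ∈ Finset.range n, a n k i * (ε i ω : ℂ) =
      ∑ i ∈ Finset.range n, a n k i * ((tr i (ε i ω) - c i : ℝ) : ℂ) +
      (∑ i ∈ Finset.range n, a n k i * (c i : ℂ) -
        ∑ i ∈ Finset.range n, a n k i * ((tr i (ε i ω) - ε i ω : ℝ) : ℂ)) := by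
    rw [← Finset.sum_sub_distrib, ← Finset.sum_add_distrib]
    refine Finset.sum_congr rfl fun i _ => ?_
    push_cast
    ring
  have hb1 : ‖∑ i ∈ Finset.range n, a n k i * (c i : ℂ)‖ ≤ A * (2 * V) * √n := by
    calc ‖∑ i ∈ Finset.range n, a n k i * (c i : ℂ)‖
        ≤ ∑ i ∈ Finset.range n, A * (V * (1 / √((i : ℝ) + 1))) := by
          refine norm_sum_le_of_le _ fun i hi => ?_
          rw [norm_mul, Complex.norm_real, Real.norm_eq_abs]
          exact mul_le_mul (ha n hnN k i (Finset.mem_range.1 hi)) (hcb2 i) (abs_nonneg _) hA.le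
      _ = A * V * ∑ i ∈ Finset.range n, 1 / √((i : ℝ) + 1) := by
          rw [Finset.mul_sum]
          exact Finset.sum_congr rfl fun i _ => by ring
      _ ≤ A * V * (2 * √n) := by gcongr; exact sum_inv_sqrt_le n
      _ = _ := by ring
  have hb2 : ‖∑ i ∈ Finset.range n, a n k i * ((tr i (ε i ω) - ε i ω : ℝ) : ℂ)‖ ≤ A * K := by
    calc ‖∑ i ∈ Finset.range n, a n k i * ((tr i (ε i ω) - ε i ω : ℝ) : ℂ)‖
        ≤ ∑ i ∈ Finset.range n, A * |truncation (ε i) (√((i : ℝ) + 1)) ω - ε i ω| := by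
          refine norm_sum_le_of_le _ fun i hi => ?_
          rw [norm_mul, Complex.norm_real, Real.norm_eq_abs]
          exact mul_le_mul_of_nonneg_right (ha n hnN k i (Finset.mem_range.1 hi)) (abs_nonneg _)
      _ ≤ A * K := by
          rw [← Finset.mul_sum]
          gcongr
          exact hsum.sum_le_tsum _ fun i _ => abs_nonneg _
  have hsL : √(n : ℝ) ≤ √n * L := le_mul_of_one_le_right (by positivity) hL1
  have hsL1 : 1 ≤ √(n : ℝ) * L := hs1.trans hsL
  rw [hsplit]
  calc _ ≤ 2 * B * (m + 2) * (√n * L) + (A * (2 * V) * √n + A * K) :=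
        (norm_add_le _ _).trans (add_le_add (hn k) ((norm_sub_le _ _).trans (add_le_add hb1 hb2)))
    _ ≤ 2 * B * (m + 2) * (√n * L) + (A * (2 * V) * (√n * L) + A * K * (√n * L)) := by
        have h7 : A * K ≤ A * K * (√n * L) := le_mul_of_one_le_right (by positivity) hsL1
        gcongr
    _ = (2 * B * (m + 2) + A * (2 * V) + A * K) * (√n * L) := by ring
    _ ≤ _ := by
        gcongr
        exact Nat.le_ceil _

/-- Weighted sums of the errors, with weights that depend on the design. As the design is
independent of the errors, the bound for deterministic weights applies conditionally. -/
lemma ae_eventually_norm_weighted_sum_le_of_indepFun {m : ℕ} {S : Type*} [MeasurableSpace S]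
    {X : Ω → S} {ε : ℕ → Ω → ℝ} (hX_meas : Measurable X) (hε_meas : ∀ j, Measurable (ε j))
    (hε_indep : iIndepFun ε μ) (hε_ident : ∀ j, IdentDistrib (ε j) (ε 0) μ μ)
    (hε_mean : ∫ ω, ε 0 ω ∂μ = 0) (h2 : MemLp (ε 0) 2 μ)
    (hXε : IndepFun X (fun ω j => ε j ω) μ)
    (a : S → ℕ → (Fin m → ℤ) → ℕ → ℂ) (ha_meas : ∀ n k i, Measurable fun x => a x n k i)
    (ha : ∀ᵐ ω ∂μ, ∃ A : ℕ, ∀ᶠ n : ℕ in atTop, ∀ k, ∀ i < n, ‖a (X ω) n k i‖ ≤ A) :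
    ∀ᵐ ω ∂μ, ∃ C : ℕ, ∀ᶠ n : ℕ in atTop, ∀ k : Fin m → ℤ,
      ‖∑ i ∈ Finset.range n, a (X ω) n k i * (ε i ω : ℂ)‖ ≤
        C * (√n * (Real.log n + Real.log (2 + ‖latticePoint k‖))) := by
  have hεm : Measurable fun ω j => ε j ω := measurable_pi_lambda _ hε_meas
  set G : Set S := {x | ∃ A : ℕ, ∀ᶠ n : ℕ in atTop, ∀ k, ∀ i < n, ‖a x n k i‖ ≤ A} with hG
  set T : Set (S × (ℕ → ℝ)) := {p | ∃ C : ℕ, ∀ᶠ n : ℕ in atTop, ∀ k : Fin m → ℤ,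
      ‖∑ i ∈ Finset.range n, a p.1 n k i * (p.2 i : ℂ)‖ ≤
        C * (√n * (Real.log n + Real.log (2 + ‖latticePoint k‖)))} with hT
  have hGm : MeasurableSet G := by
    simp only [hG, eventually_atTop, Set.ofPred_exists, Set.ofPred_forall]
    refine MeasurableSet.iUnion fun A => MeasurableSet.iUnion fun N => MeasurableSet.iInter fun n =>
      MeasurableSet.iInter fun _ => MeasurableSet.iInter fun k => MeasurableSet.iInter fun i =>
      MeasurableSet.iInter fun _ => ?_
    exact measurableSet_le (ha_meas n k i).norm measurable_const
  have hTm : MeasurableSet T := by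
    simp only [hT, eventually_atTop, Set.ofPred_exists, Set.ofPred_forall]
    refine MeasurableSet.iUnion fun C => MeasurableSet.iUnion fun N => MeasurableSet.iInter fun n =>
      MeasurableSet.iInter fun _ => MeasurableSet.iInter fun k => ?_
    refine measurableSet_le (Measurable.norm (Finset.measurable_sum _ fun i _ => ?_))
      measurable_const
    exact ((ha_meas n k i).comp measurable_fst).mul
      (Complex.measurable_ofReal.comp ((measurable_pi_apply i).comp measurable_snd))
  have hprod := (indepFun_iff_map_prod_eq_prod_map_map hX_meas.aemeasurable hεm.aemeasurable).1 hXε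
  have hGae : ∀ᵐ x ∂(μ.map X), x ∈ G := (ae_map_iff hX_meas.aemeasurable hGm).2 ha
  have := Measure.isProbabilityMeasure_map (μ := μ) hX_meas.aemeasurable
  have := Measure.isProbabilityMeasure_map (μ := μ) hεm.aemeasurable
  have hmain : ∀ᵐ p ∂((μ.map X).prod (μ.map fun ω j => ε j ω)), p ∈ T := by
    rw [Measure.ae_prod_mem_iff_ae_ae_mem hTm]
    filter_upwards [hGae] with x hx
    obtain ⟨A, hA⟩ := hx
    obtain ⟨N, hN⟩ := eventually_atTop.1 hA
    rw [ae_map_iff hεm.aemeasurable (measurable_prodMk_left hTm)]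
    exact ae_eventually_norm_weighted_sum_le hε_meas hε_indep hε_ident hε_mean h2 (a x) N hN
  rw [← hprod] at hmain
  exact (ae_map_iff (hX_meas.prodMk hεm).aemeasurable hTm).1 hmain

end Concentration

/-! ### Characters and absolutely convergent Fourier series -/

lemma fourierChar_add {m : ℕ} (k l : Fin m → ℤ) (x : EuclideanSpace ℝ (Fin m)) :
    fourierChar (k + l) x = fourierChar k x * fourierChar l x := by
  simp only [fourierChar, ← Complex.exp_add]
  congr 1
  simp only [Pi.add_apply, Int.cast_add, add_mul, Finset.sum_add_distrib]
  push_cast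
  ring

lemma fourierChar_sub_right {m : ℕ} (k : Fin m → ℤ) (x y : EuclideanSpace ℝ (Fin m)) :
    fourierChar k (x - y) = fourierChar k x * fourierChar (-k) y := by
  simp only [fourierChar, ← Complex.exp_add]
  congr 1
  simp only [PiLp.sub_apply, Pi.neg_apply, Int.cast_neg, mul_sub, neg_mul, Finset.sum_sub_distrib,
    Finset.sum_neg_distrib]
  push_cast
  ring

lemma fourierChar_neg_right {m : ℕ} (k : Fin m → ℤ) (x : EuclideanSpace ℝ (Fin m)) :
    fourierChar k (-x) = fourierChar (-k) x := by
  simp [fourierChar]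

lemma conj_fourierChar {m : ℕ} (k : Fin m → ℤ) (x : EuclideanSpace ℝ (Fin m)) :
    (starRingEnd ℂ) (fourierChar k x) = fourierChar (-k) x := by
  simp only [fourierChar, ← Complex.exp_conj]
  congr 1
  have h2 : (starRingEnd ℂ) 2 = 2 := Complex.conj_ofNat 2
  simp [Complex.conj_ofReal, h2]

lemma summable_mul_fourierChar {m : ℕ} {a : (Fin m → ℤ) → ℂ} (ha : Summable fun k => ‖a k‖)
    (x : EuclideanSpace ℝ (Fin m)) : Summable fun k => a k * fourierChar k x := by
  refine .of_norm ?_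
  simpa only [norm_mul, norm_fourierChar, mul_one] using ha

lemma norm_tsum_mul_fourierChar_le {m : ℕ} {a : (Fin m → ℤ) → ℂ} (ha : Summable fun k => ‖a k‖)
    (x : EuclideanSpace ℝ (Fin m)) : ‖∑' k, a k * fourierChar k x‖ ≤ ∑' k, ‖a k‖ := by
  have h := norm_tsum_le_tsum_norm (f := fun k => a k * fourierChar k x) (by
    simpa only [norm_mul, norm_fourierChar, mul_one] using ha)
  simpa only [norm_mul, norm_fourierChar, mul_one] using h

lemma continuous_tsum_mul_fourierChar {m : ℕ} {a : (Fin m → ℤ) → ℂ}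
    (ha : Summable fun k => ‖a k‖) :
    Continuous fun x : EuclideanSpace ℝ (Fin m) => ∑' k, a k * fourierChar k x := by
  refine continuous_tsum (fun k => continuous_const.mul (continuous_fourierChar k)) ha
    fun k x => ?_
  simp [norm_fourierChar]

/-! ### The smoothing operator at the design points -/

/-- The empirical Fourier coefficient `n⁻¹ ∑_{i<n} u_i exp(-i 2π k·x_i)`. -/
noncomputable def empCoeff {m : ℕ} (n : ℕ) (x : ℕ → EuclideanSpace ℝ (Fin m)) (u : ℕ → ℂ)
    (k : Fin m → ℤ) : ℂ :=
  (1 / (n : ℂ)) * ∑ i ∈ Finset.range n, u i * fourierChar (-k) (x i)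

/-- The smoothing operator: it maps the values `u_i` at the design points `x_i` to the function
`t ↦ n⁻¹ ∑_{i<n} u_i W_c(t - x_i)`. -/
noncomputable def smoother {m : ℕ} (Λ : EuclideanSpace ℝ (Fin m) → ℝ) (c : ℝ) (n : ℕ)
    (x : ℕ → EuclideanSpace ℝ (Fin m)) (u : ℕ → ℂ) (t : EuclideanSpace ℝ (Fin m)) : ℂ :=
  (1 / (n : ℂ)) * ∑ i ∈ Finset.range n, u i * smoothingWeight Λ c (t - x i)

/-- The weight `(1 + ‖c k‖)^{1/2}` of the frequency `k`. The square root allows the product of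
two coefficients bounded by it to be summed against a kernel with a first moment. -/
noncomputable def freqWeight {m : ℕ} (c : ℝ) (k : Fin m → ℤ) : ℝ := √(1 + ‖c • latticePoint k‖)

/-- The first moment `∑_k |Λ(c k)| (1 + ‖c k‖)` of the kernel over the lattice. -/
noncomputable def kernelMass {m : ℕ} (Λ : EuclideanSpace ℝ (Fin m) → ℝ) (c : ℝ) : ℝ :=
  ∑' k : Fin m → ℤ, |Λ (c • latticePoint k)| * freqWeight c k ^ 2

lemma one_le_freqWeight {m : ℕ} (c : ℝ) (k : Fin m → ℤ) : 1 ≤ freqWeight c k := by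
  rw [freqWeight, Real.one_le_sqrt]
  linarith [norm_nonneg (c • latticePoint k)]

lemma freqWeight_sq {m : ℕ} (c : ℝ) (k : Fin m → ℤ) :
    freqWeight c k ^ 2 = 1 + ‖c • latticePoint k‖ := Real.sq_sqrt (by positivity)

lemma freqWeight_le_sq {m : ℕ} (c : ℝ) (k : Fin m → ℤ) : freqWeight c k ≤ freqWeight c k ^ 2 := by
  have := one_le_freqWeight c k
  nlinarith

lemma freqWeight_neg {m : ℕ} (c : ℝ) (k : Fin m → ℤ) : freqWeight c (-k) = freqWeight c k := by
  simp [freqWeight, latticePoint_neg]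

lemma freqWeight_add_le {m : ℕ} (c : ℝ) (k l : Fin m → ℤ) :
    freqWeight c (k + l) ≤ freqWeight c k * freqWeight c l := by
  rw [freqWeight, freqWeight, freqWeight, ← Real.sqrt_mul (by positivity)]
  apply Real.sqrt_le_sqrt
  rw [latticePoint_add, smul_add]
  nlinarith [norm_add_le (c • latticePoint k) (c • latticePoint l),
    norm_nonneg (c • latticePoint k), norm_nonneg (c • latticePoint l)]

section Smoother

variable {m : ℕ} {Λ : EuclideanSpace ℝ (Fin m) → ℝ} {c : ℝ} {n : ℕ}
  {x : ℕ → EuclideanSpace ℝ (Fin m)}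

lemma densityEst_eq_smoother (t : EuclideanSpace ℝ (Fin m)) :
    densityEst Λ c n x t = smoother Λ c n x (fun _ => 1) t := by
  simp [densityEst, smoother]

lemma smoother_eq_tsum (hs : Summable fun k : Fin m → ℤ => |Λ (c • latticePoint k)|)
    (u : ℕ → ℂ) (t : EuclideanSpace ℝ (Fin m)) :
    smoother Λ c n x u t =
      ∑' k : Fin m → ℤ, (Λ (c • latticePoint k) : ℂ) * empCoeff n x u k * fourierChar k t := by
  have hs' : Summable fun k : Fin m → ℤ => ‖(Λ (c • latticePoint k) : ℂ)‖ := by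
    simpa only [Complex.norm_real, Real.norm_eq_abs] using hs
  have h1 : ∀ i, u i * smoothingWeight Λ c (t - x i) =
      ∑' k : Fin m → ℤ, u i * ((Λ (c • latticePoint k) : ℂ) * fourierChar k (t - x i)) :=
    fun i => by rw [smoothingWeight, tsum_mul_left]
  rw [smoother]
  simp only [h1]
  rw [← Summable.tsum_finsetSum fun i _ => (summable_mul_fourierChar hs' _).mul_left _,
    ← tsum_mul_left]
  refine tsum_congr fun k => ?_
  rw [empCoeff, Finset.mul_sum, Finset.mul_sum, Finset.mul_sum, Finset.sum_mul]
  refine Finset.sum_congr rfl fun i _ => ?_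
  rw [fourierChar_sub_right]
  ring

lemma regressionEst_eq_smoother (hs : Summable fun k : Fin m → ℤ => |Λ (c • latticePoint k)|)
    (y : ℕ → ℝ) (t : EuclideanSpace ℝ (Fin m)) :
    regressionEst Λ c n x y t =
      smoother Λ c n x (fun j => (y j : ℂ) / densityEst Λ c n x (x j)) t := by
  rw [smoother_eq_tsum hs]
  rfl

lemma smoothingWeight_neg (hΛ : RadiallySymmetric Λ) (t : EuclideanSpace ℝ (Fin m)) :
    smoothingWeight Λ c (-t) = smoothingWeight Λ c t := by
  rw [smoothingWeight, smoothingWeight, ← (Equiv.neg (Fin m → ℤ)).tsum_eq]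
  refine tsum_congr fun k => ?_
  rw [Equiv.neg_apply, fourierChar_neg_right, neg_neg, latticePoint_neg, smul_neg,
    hΛ (-(c • latticePoint k)) (c • latticePoint k) (norm_neg _)]

/-- For a radially symmetric kernel the columns of the smoothing matrix sum to the density
estimate, so that smoothing preserves means after division by the density estimate. -/
lemma mean_regressionEst (hΛ : RadiallySymmetric Λ)
    (hs : Summable fun k : Fin m → ℤ => |Λ (c • latticePoint k)|)
    (hd : ∀ j ∈ Finset.range n, densityEst Λ c n x (x j) ≠ 0) (y : ℕ → ℝ) :
    (1 / (n : ℂ)) * ∑ j ∈ Finset.range n, regressionEst Λ c n x y (x j) =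
      (1 / (n : ℂ)) * ∑ j ∈ Finset.range n, (y j : ℂ) := by
  congr 1
  simp only [regressionEst_eq_smoother hs, smoother]
  rw [← Finset.mul_sum, Finset.sum_comm, Finset.mul_sum]
  refine Finset.sum_congr rfl fun i hi => ?_
  rw [← Finset.mul_sum]
  have h1 : ∑ j ∈ Finset.range n, smoothingWeight Λ c (x j - x i) =
      ∑ j ∈ Finset.range n, smoothingWeight Λ c (x i - x j) :=
    Finset.sum_congr rfl fun j _ => by rw [← smoothingWeight_neg hΛ, neg_sub]
  have h2 : (1 / (n : ℂ)) * ∑ j ∈ Finset.range n, smoothingWeight Λ c (x i - x j) =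
      densityEst Λ c n x (x i) := rfl
  rw [h1, mul_left_comm, h2, div_mul_cancel₀ _ (hd i hi)]

lemma summable_abs_of_kernelMass
    (hs : Summable fun k : Fin m → ℤ => |Λ (c • latticePoint k)| * freqWeight c k ^ 2) :
    Summable fun k : Fin m → ℤ => |Λ (c • latticePoint k)| := by
  refine Summable.of_nonneg_of_le (fun k => abs_nonneg _) (fun k => ?_) hs
  exact le_mul_of_one_le_right (abs_nonneg _) (one_le_pow₀ (one_le_freqWeight c k))

lemma summable_abs_mul_freqWeight
    (hs : Summable fun k : Fin m → ℤ => |Λ (c • latticePoint k)| * freqWeight c k ^ 2) :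
    Summable fun k : Fin m → ℤ => |Λ (c • latticePoint k)| * freqWeight c k := by
  refine Summable.of_nonneg_of_le (fun k => mul_nonneg (abs_nonneg _)
    (zero_le_one.trans (one_le_freqWeight c k))) (fun k => ?_) hs
  exact mul_le_mul_of_nonneg_left (freqWeight_le_sq c k) (abs_nonneg _)

lemma tsum_abs_mul_freqWeight_le
    (hs : Summable fun k : Fin m → ℤ => |Λ (c • latticePoint k)| * freqWeight c k ^ 2) :
    ∑' k : Fin m → ℤ, |Λ (c • latticePoint k)| * freqWeight c k ≤ kernelMass Λ c :=
  (summable_abs_mul_freqWeight hs).tsum_le_tsum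
    (fun k => mul_le_mul_of_nonneg_left (freqWeight_le_sq c k) (abs_nonneg _)) hs

lemma tsum_abs_le_kernelMass
    (hs : Summable fun k : Fin m → ℤ => |Λ (c • latticePoint k)| * freqWeight c k ^ 2) :
    ∑' k : Fin m → ℤ, |Λ (c • latticePoint k)| ≤ kernelMass Λ c :=
  (summable_abs_of_kernelMass hs).tsum_le_tsum
    (fun k => le_mul_of_one_le_right (abs_nonneg _) (one_le_pow₀ (one_le_freqWeight c k))) hs

lemma kernelMass_nonneg : 0 ≤ kernelMass Λ c :=
  tsum_nonneg fun _ => mul_nonneg (abs_nonneg _) (sq_nonneg _)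

/-- A Fourier series damped by the kernel, with coefficients of order `freqWeight`. -/
lemma norm_tsum_kernel_le
    (hs : Summable fun k : Fin m → ℤ => |Λ (c • latticePoint k)| * freqWeight c k ^ 2)
    {a : (Fin m → ℤ) → ℂ} {R : ℝ} (ha : ∀ k, ‖a k‖ ≤ R * freqWeight c k)
    (t : EuclideanSpace ℝ (Fin m)) :
    (Summable fun k : Fin m → ℤ => ‖(Λ (c • latticePoint k) : ℂ) * a k‖) ∧
    ‖∑' k : Fin m → ℤ, (Λ (c • latticePoint k) : ℂ) * a k * fourierChar k t‖ ≤
      R * kernelMass Λ c := by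
  have hR : 0 ≤ R := by
    have h1 := (norm_nonneg _).trans (ha 0)
    exact nonneg_of_mul_nonneg_left h1 (zero_lt_one.trans_le (one_le_freqWeight c 0))
  have hle : ∀ k, ‖(Λ (c • latticePoint k) : ℂ) * a k‖ ≤
      R * (|Λ (c • latticePoint k)| * freqWeight c k) := by
    intro k
    rw [norm_mul, Complex.norm_real, Real.norm_eq_abs]
    nlinarith [mul_le_mul_of_nonneg_left (ha k) (abs_nonneg (Λ (c • latticePoint k)))]
  have hsum : Summable fun k : Fin m → ℤ => ‖(Λ (c • latticePoint k) : ℂ) * a k‖ :=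
    Summable.of_nonneg_of_le (fun k => norm_nonneg _) hle
      ((summable_abs_mul_freqWeight hs).mul_left R)
  refine ⟨hsum, (norm_tsum_mul_fourierChar_le hsum t).trans ?_⟩
  refine (hsum.tsum_le_tsum hle ((summable_abs_mul_freqWeight hs).mul_left R)).trans ?_
  rw [tsum_mul_left]
  exact mul_le_mul_of_nonneg_left (tsum_abs_mul_freqWeight_le hs) hR

/-- Smoothing errors: if the empirical coefficients of `u` are close to `b`, the smoother of `u` is
close to the Fourier series with coefficients `b`, up to the bias of the kernel. -/
lemma norm_smoother_sub_tsum_le (hΛ1 : IsFourierKernel Λ) (hc : 0 < c)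
    (hs : Summable fun k : Fin m → ℤ => |Λ (c • latticePoint k)| * freqWeight c k ^ 2)
    {u : ℕ → ℂ} {b : (Fin m → ℤ) → ℂ} {R p : ℝ} (hp : 0 < p)
    (hu : ∀ k, ‖empCoeff n x u k - b k‖ ≤ R * freqWeight c k)
    (hb : Summable fun k => ‖b k‖) (hbp : Summable fun k => ‖latticePoint k‖ ^ p * ‖b k‖)
    (t : EuclideanSpace ℝ (Fin m)) :
    ‖smoother Λ c n x u t - ∑' k, b k * fourierChar k t‖ ≤
      R * kernelMass Λ c + 2 * c ^ p * ∑' k, ‖latticePoint k‖ ^ p * ‖b k‖ := by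
  obtain ⟨h1, h2⟩ := norm_tsum_kernel_le hs hu t
  have hle : ∀ k, ‖((Λ (c • latticePoint k) : ℂ) - 1) * b k‖ ≤
      2 * c ^ p * (‖latticePoint k‖ ^ p * ‖b k‖) := by
    intro k
    rw [norm_mul, ← mul_assoc]
    refine mul_le_mul_of_nonneg_right ?_ (norm_nonneg _)
    rcases le_or_gt ‖c • latticePoint k‖ 1 with h | h
    · rw [hΛ1.eq_one _ h]
      simp only [Complex.ofReal_one, sub_self, norm_zero]
      positivity
    · have h3 : 1 ≤ c ^ p * ‖latticePoint k‖ ^ p := by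
        rw [← Real.mul_rpow hc.le (norm_nonneg _)]
        rw [norm_smul, Real.norm_of_nonneg hc.le] at h
        exact Real.one_le_rpow h.le hp.le
      have h4 : ‖(Λ (c • latticePoint k) : ℂ) - 1‖ ≤ 2 := by
        refine (norm_sub_le _ _).trans ?_
        rw [Complex.norm_real, Real.norm_eq_abs, norm_one]
        linarith [hΛ1.abs_le_one _ h]
      linarith
  have hsb : Summable fun k => ‖((Λ (c • latticePoint k) : ℂ) - 1) * b k‖ :=
    Summable.of_nonneg_of_le (fun k => norm_nonneg _) hle (hbp.mul_left _)
  have h5 : ‖∑' k, ((Λ (c • latticePoint k) : ℂ) - 1) * b k * fourierChar k t‖ ≤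
      2 * c ^ p * ∑' k, ‖latticePoint k‖ ^ p * ‖b k‖ := by
    refine (norm_tsum_mul_fourierChar_le hsb t).trans ?_
    rw [← tsum_mul_left]
    exact hsb.tsum_le_tsum hle (hbp.mul_left _)
  have h6 : smoother Λ c n x u t - ∑' k, b k * fourierChar k t =
      (∑' k, (Λ (c • latticePoint k) : ℂ) * (empCoeff n x u k - b k) * fourierChar k t) +
      ∑' k, ((Λ (c • latticePoint k) : ℂ) - 1) * b k * fourierChar k t := by
    have s1 := summable_mul_fourierChar h1 t
    have s2 := summable_mul_fourierChar hsb t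
    have s3 := summable_mul_fourierChar hb t
    rw [smoother_eq_tsum (summable_abs_of_kernelMass hs), ← s1.tsum_add s2, sub_eq_iff_eq_add,
      ← (s1.add s2).tsum_add s3]
    exact tsum_congr fun k => by ring
  rw [h6]
  exact (norm_add_le _ _).trans (add_le_add h2 h5)

lemma abs_le_one_of_isFourierKernel (hΛ1 : IsFourierKernel Λ) (u : EuclideanSpace ℝ (Fin m)) :
    |Λ u| ≤ 1 := by
  rcases le_or_gt ‖u‖ 1 with h | h
  · simp [hΛ1.eq_one u h]
  · exact hΛ1.abs_le_one u h

/-- The empirical mean square of the smoothing weights. When the empirical coefficients of the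
design are close to an absolutely summable sequence, it is essentially of the order of the kernel
mass, whereas the supremum of the squared weights is of the order of the square of that mass. -/
lemma mean_norm_smoothingWeight_sq_le (hΛ1 : IsFourierKernel Λ)
    (hs : Summable fun k : Fin m → ℤ => |Λ (c • latticePoint k)| * freqWeight c k ^ 2)
    {b : (Fin m → ℤ) → ℂ} {R : ℝ} (hR : 0 ≤ R)
    (hu : ∀ k, ‖empCoeff n x (fun _ => 1) k - b k‖ ≤ R * freqWeight c k)
    (hb : Summable fun k => ‖b k‖) (t : EuclideanSpace ℝ (Fin m)) :
    (1 / (n : ℝ)) * ∑ i ∈ Finset.range n, ‖smoothingWeight Λ c (t - x i)‖ ^ 2 ≤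
      (∑' k, ‖b k‖) * kernelMass Λ c + R * kernelMass Λ c ^ 2 := by
  set M := kernelMass Λ c with hM
  set Γ := ∑' k, ‖b k‖ with hΓ
  have hM0 : 0 ≤ M := kernelMass_nonneg
  have hs0 := summable_abs_of_kernelMass hs
  -- The mean square is the smoother of the conjugate weights, whose empirical coefficients are in
  -- turn smoothers of characters.
  set v : ℕ → ℂ := fun i => (starRingEnd ℂ) (smoothingWeight Λ c (t - x i)) with hv
  have hemp : ∀ k, (starRingEnd ℂ) (empCoeff n x v k) =
      smoother Λ c n x (fun i => fourierChar k (x i)) t := by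
    intro k
    simp only [empCoeff, smoother, map_mul, map_sum, map_div₀, map_one, Complex.conj_natCast, hv,
      Complex.conj_conj, conj_fourierChar, neg_neg]
    congr 1
    exact Finset.sum_congr rfl fun i _ => mul_comm _ _
  have hcoef : ∀ k, ‖empCoeff n x v k‖ ≤ Γ + R * M * freqWeight c k := by
    intro k
    rw [← Complex.norm_conj, hemp, smoother_eq_tsum hs0]
    have h1 : ∀ l, empCoeff n x (fun i => fourierChar k (x i)) l =
        empCoeff n x (fun _ => 1) (l - k) := by
      intro l
      simp only [empCoeff, one_mul, ← fourierChar_add]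
      congr 1
      refine Finset.sum_congr rfl fun i _ => ?_
      congr 1
      abel
    have hw : 0 ≤ freqWeight c k := zero_le_one.trans (one_le_freqWeight c k)
    have h2 : ∀ l, ‖(Λ (c • latticePoint l) : ℂ) * empCoeff n x (fun i => fourierChar k (x i)) l‖ ≤
        ‖b (l - k)‖ + R * freqWeight c k * (|Λ (c • latticePoint l)| * freqWeight c l) := by
      intro l
      rw [h1, norm_mul, Complex.norm_real, Real.norm_eq_abs]
      have h3 : ‖empCoeff n x (fun _ => 1) (l - k)‖ ≤
          ‖b (l - k)‖ + R * (freqWeight c l * freqWeight c k) := by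
        have h4 := norm_le_norm_add_norm_sub' (empCoeff n x (fun _ => 1) (l - k)) (b (l - k))
        have h5 := freqWeight_add_le c l (-k)
        rw [freqWeight_neg, ← sub_eq_add_neg] at h5
        have h6 := mul_le_mul_of_nonneg_left h5 hR
        linarith [hu (l - k)]
      have h7 := mul_le_mul_of_nonneg_left h3 (abs_nonneg (Λ (c • latticePoint l)))
      have h8 := mul_le_mul_of_nonneg_right
        (abs_le_one_of_isFourierKernel hΛ1 (c • latticePoint l)) (norm_nonneg (b (l - k)))
      refine h7.trans ?_
      rw [mul_add]
      refine add_le_add (h8.trans_eq (one_mul _)) (le_of_eq (by ring))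
    have hbs : Summable fun l => ‖b (l - k)‖ := (Equiv.subRight k).summable_iff.2 hb
    have hsw := (summable_abs_mul_freqWeight hs).mul_left (R * freqWeight c k)
    have h9 := Summable.of_nonneg_of_le (fun l => norm_nonneg _) h2 (hbs.add hsw)
    refine (norm_tsum_mul_fourierChar_le h9 t).trans ?_
    refine (h9.tsum_le_tsum h2 (hbs.add hsw)).trans ?_
    have h11 : ∑' l, ‖b (l - k)‖ = Γ := (Equiv.subRight k).tsum_eq fun l => ‖b l‖
    rw [hbs.tsum_add hsw, tsum_mul_left, h11]
    have h10 := mul_le_mul_of_nonneg_left (tsum_abs_mul_freqWeight_le hs) (mul_nonneg hR hw)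
    rw [← hM] at h10
    linarith
  have hsq : (((1 / (n : ℝ)) * ∑ i ∈ Finset.range n, ‖smoothingWeight Λ c (t - x i)‖ ^ 2 : ℝ) : ℂ)
      = smoother Λ c n x v t := by
    rw [smoother]
    push_cast
    congr 1
    refine Finset.sum_congr rfl fun i _ => ?_
    rw [hv, Complex.conj_mul']
  have hle : ∀ k, ‖(Λ (c • latticePoint k) : ℂ) * empCoeff n x v k‖ ≤
      Γ * |Λ (c • latticePoint k)| + R * M * (|Λ (c • latticePoint k)| * freqWeight c k) := by
    intro k
    rw [norm_mul, Complex.norm_real, Real.norm_eq_abs]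
    refine (mul_le_mul_of_nonneg_left (hcoef k) (abs_nonneg _)).trans (le_of_eq (by ring))
  have t1 := hs0.mul_left Γ
  have t2 := (summable_abs_mul_freqWeight hs).mul_left (R * M)
  have h11 := Summable.of_nonneg_of_le (fun l => norm_nonneg _) hle (t1.add t2)
  have h12 : ‖smoother Λ c n x v t‖ ≤ Γ * M + R * M ^ 2 := by
    rw [smoother_eq_tsum hs0]
    refine (norm_tsum_mul_fourierChar_le h11 t).trans
      ((h11.tsum_le_tsum hle (t1.add t2)).trans ?_)
    rw [t1.tsum_add t2, tsum_mul_left, tsum_mul_left]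
    have hΓ0 : 0 ≤ Γ := tsum_nonneg fun k => norm_nonneg _
    have h13 := mul_le_mul_of_nonneg_left (tsum_abs_le_kernelMass hs) hΓ0
    have h14 := mul_le_mul_of_nonneg_left (tsum_abs_mul_freqWeight_le hs) (mul_nonneg hR hM0)
    rw [← hM] at h13 h14
    nlinarith
  rw [← hsq, Complex.norm_real] at h12
  exact (le_abs_self _).trans h12

/-- The operator norm of the smoother from bounded vectors, by the Cauchy–Schwarz inequality. -/
lemma norm_smoother_le {u : ℕ → ℂ} {Q ρ : ℝ} (hn : 1 ≤ n) (hρ : 0 ≤ ρ)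
    (hu : ∀ i < n, ‖u i‖ ≤ ρ) (t : EuclideanSpace ℝ (Fin m))
    (hQ : (1 / (n : ℝ)) * ∑ i ∈ Finset.range n, ‖smoothingWeight Λ c (t - x i)‖ ^ 2 ≤ Q) :
    ‖smoother Λ c n x u t‖ ≤ ρ * √Q := by
  have hn' : (0 : ℝ) < n := by exact_mod_cast hn
  set W : ℕ → ℝ := fun i => ‖smoothingWeight Λ c (t - x i)‖ with hW
  have h1 : ‖smoother Λ c n x u t‖ ≤ ρ * ((1 / (n : ℝ)) * ∑ i ∈ Finset.range n, W i) := by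
    rw [smoother, norm_mul, norm_div, norm_one, Complex.norm_natCast, mul_left_comm]
    gcongr
    rw [Finset.mul_sum]
    refine norm_sum_le_of_le _ fun i hi => ?_
    rw [norm_mul]
    gcongr
    exact hu i (Finset.mem_range.1 hi)
  refine h1.trans (mul_le_mul_of_nonneg_left ?_ hρ)
  apply Real.le_sqrt_of_sq_le
  refine le_trans ?_ hQ
  have h2 := sq_sum_le_card_mul_sum_sq (s := Finset.range n) (f := W)
  rw [Finset.card_range] at h2
  rw [mul_pow, div_pow, one_pow]
  calc 1 / (n : ℝ) ^ 2 * (∑ i ∈ Finset.range n, W i) ^ 2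
      ≤ 1 / (n : ℝ) ^ 2 * (n * ∑ i ∈ Finset.range n, W i ^ 2) := by gcongr
    _ = 1 / (n : ℝ) * ∑ i ∈ Finset.range n, W i ^ 2 := by field_simp

/-- The quadratic form of the smoother, evaluated on the Fourier side. -/
lemma norm_mean_mul_smoother_le
    (hs : Summable fun k : Fin m → ℤ => |Λ (c • latticePoint k)| * freqWeight c k ^ 2)
    {u v : ℕ → ℂ} {R R' : ℝ} (hu : ∀ k, ‖empCoeff n x u k‖ ≤ R * freqWeight c k)
    (hv : ∀ k, ‖empCoeff n x v k‖ ≤ R' * freqWeight c k) :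
    ‖(1 / (n : ℂ)) * ∑ j ∈ Finset.range n, v j * smoother Λ c n x u (x j)‖ ≤
      R * R' * kernelMass Λ c := by
  obtain ⟨h1, -⟩ := norm_tsum_kernel_le hs hu 0
  have h2 : (1 / (n : ℂ)) * ∑ j ∈ Finset.range n, v j * smoother Λ c n x u (x j) =
      ∑' k : Fin m → ℤ, (Λ (c • latticePoint k) : ℂ) * empCoeff n x u k * empCoeff n x v (-k) := by
    simp only [smoother_eq_tsum (summable_abs_of_kernelMass hs), ← tsum_mul_left]
    rw [← Summable.tsum_finsetSum fun j _ => (summable_mul_fourierChar h1 _).mul_left _,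
      ← tsum_mul_left]
    refine tsum_congr fun k => ?_
    conv_rhs => rw [empCoeff.eq_1 n x v]
    rw [neg_neg, mul_left_comm, Finset.mul_sum (a := _ * _)]
    congr 1
    exact Finset.sum_congr rfl fun j _ => by ring
  have hle : ∀ k : Fin m → ℤ,
      ‖(Λ (c • latticePoint k) : ℂ) * empCoeff n x u k * empCoeff n x v (-k)‖ ≤
        R * R' * (|Λ (c • latticePoint k)| * freqWeight c k ^ 2) := by
    intro k
    rw [norm_mul, norm_mul, Complex.norm_real, Real.norm_eq_abs, mul_assoc]
    have h3 := hv (-k)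
    rw [freqWeight_neg] at h3
    have h4 := mul_le_mul (hu k) h3 (norm_nonneg _) ((norm_nonneg _).trans (hu k))
    refine (mul_le_mul_of_nonneg_left h4 (abs_nonneg _)).trans (le_of_eq (by ring))
  have h5 := Summable.of_nonneg_of_le (fun k => norm_nonneg _) hle (hs.mul_left _)
  rw [h2]
  refine (norm_tsum_le_tsum_norm h5).trans ((h5.tsum_le_tsum hle (hs.mul_left _)).trans ?_)
  rw [tsum_mul_left, kernelMass]

end Smoother

/-! ### Deterministic bounds for one sample -/

section OneSample

variable {m : ℕ} {Λ : EuclideanSpace ℝ (Fin m) → ℝ} {c : ℝ} {n : ℕ}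
  {x : ℕ → EuclideanSpace ℝ (Fin m)}

/-- The error at the design point `x_j` of the smoother applied to noiseless data `f(x_i)`. -/
noncomputable def smoothingError {m : ℕ} (Λ : EuclideanSpace ℝ (Fin m) → ℝ) (c : ℝ) (n : ℕ)
    (x : ℕ → EuclideanSpace ℝ (Fin m)) (f : EuclideanSpace ℝ (Fin m) → ℝ) (j : ℕ) : ℂ :=
  smoother Λ c n x (fun i => (f (x i) : ℂ) / densityEst Λ c n x (x i)) (x j) - (f (x j) : ℂ)

/-- The density estimate at the design points. Here `M` is the order `c^{-m}` of the number of
frequencies, `r` the rate of the empirical coefficients and `v` the target rate; the factor `√M`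
is what is lost later on by the Cauchy–Schwarz inequality. -/
lemma norm_densityEst_sub_mul_sqrt_le {K M r v t : ℝ} (hΛ1 : IsFourierKernel Λ) (hc : 0 < c)
    (hs : Summable fun k : Fin m → ℤ => |Λ (c • latticePoint k)| * freqWeight c k ^ 2)
    (ht : 0 < t) (hK : 1 ≤ K) (hM : 1 ≤ M) (hr : 0 ≤ r)
    (hmass : kernelMass Λ c ≤ K * M) (hcM : c ^ m * M = 1) (hct : c ^ t ≤ K * v)
    (hrM : r * M * √M ≤ K * v) {γ : (Fin m → ℤ) → ℂ} (hγ : Summable fun k => ‖γ k‖)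
    (hγp : Summable fun k => ‖latticePoint k‖ ^ (t + m) * ‖γ k‖)
    (hγK : ∑' k, ‖latticePoint k‖ ^ (t + m) * ‖γ k‖ ≤ K)
    (hemp : ∀ k, ‖empCoeff n x (fun _ => 1) k - γ k‖ ≤ K * r * freqWeight c k)
    (y : EuclideanSpace ℝ (Fin m)) :
    ‖densityEst Λ c n x y - ∑' k, γ k * fourierChar k y‖ * √M ≤ 3 * K ^ 3 * v := by
  have h1 := norm_smoother_sub_tsum_le hΛ1 hc hs (by positivity) hemp hγ hγp y
  rw [← densityEst_eq_smoother] at h1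
  have hsM : 1 ≤ √M := by rwa [Real.one_le_sqrt]
  have hsM2 : √M * √M = M := Real.mul_self_sqrt (by linarith)
  have hct0 : 0 < c ^ t := Real.rpow_pos_of_pos hc t
  have hv : 0 ≤ v := by
    have : 0 < K * v := hct0.trans_le hct
    exact (pos_of_mul_pos_right this (by linarith)).le
  -- The density is smoother than the regression function by `m` derivatives, and `c^m √M ≤ 1`.
  have h2 : c ^ (t + m) * √M ≤ c ^ t := by
    rw [Real.rpow_add hc, Real.rpow_natCast, mul_assoc]
    refine mul_le_of_le_one_right hct0.le ?_
    rw [← hcM]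
    gcongr
    nlinarith
  have h3 : K * r * kernelMass Λ c ≤ K * r * (K * M) := by gcongr
  have h4 : 2 * c ^ (t + m) * ∑' k, ‖latticePoint k‖ ^ (t + m) * ‖γ k‖ ≤ 2 * c ^ (t + m) * K := by
    gcongr
  calc _ ≤ (K * r * (K * M) + 2 * c ^ (t + m) * K) * √M :=
      mul_le_mul_of_nonneg_right (by linarith) (by positivity)
    _ = K ^ 2 * (r * M * √M) + 2 * K * (c ^ (t + m) * √M) := by ring
    _ ≤ K ^ 2 * (K * v) + 2 * K * (K * v) :=
      add_le_add (by gcongr) (mul_le_mul_of_nonneg_left (h2.trans hct) (by positivity))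
    _ ≤ 3 * K ^ 3 * v := by
      have : K ^ 2 * v ≤ K ^ 3 * v := by gcongr; norm_num
      nlinarith

/-- The smoothing error for noiseless data. Replacing the density estimate by the density leaves an
error with empirical coefficients under control; the replacement costs the error of the density
estimate times the norm `√M` of the smoother. The condition on `6 K⁴ v` keeps the density estimate
above half the lower bound `1 / K` of the density. -/
lemma norm_smoothingError_le {K M r v t : ℝ} (hn : 1 ≤ n) (hΛ1 : IsFourierKernel Λ) (hc : 0 < c)
    (hs : Summable fun k : Fin m → ℤ => |Λ (c • latticePoint k)| * freqWeight c k ^ 2)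
    (ht : 0 < t) (hK : 1 ≤ K) (hM : 1 ≤ M) (hr : 0 ≤ r) (hv1 : v ≤ 1)
    (hmass : kernelMass Λ c ≤ K * M) (hcM : c ^ m * M = 1) (hct : c ^ t ≤ K * v)
    (hrM : r * M * √M ≤ K * v) (hvK : 6 * K ^ 4 * v ≤ 1)
    {γ : (Fin m → ℤ) → ℂ} (hγ : Summable fun k => ‖γ k‖) (hγ1 : ∑' k, ‖γ k‖ ≤ K)
    (hγp : Summable fun k => ‖latticePoint k‖ ^ (t + m) * ‖γ k‖)
    (hγK : ∑' k, ‖latticePoint k‖ ^ (t + m) * ‖γ k‖ ≤ K)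
    (hemp : ∀ k, ‖empCoeff n x (fun _ => 1) k - γ k‖ ≤ K * r * freqWeight c k)
    {g f : EuclideanSpace ℝ (Fin m) → ℝ}
    (hg : ∀ i, (g (x i) : ℂ) = ∑' k, γ k * fourierChar k (x i)) (hgK : ∀ i, 1 / K ≤ g (x i))
    {a : (Fin m → ℤ) → ℂ} (ha : Summable fun k => ‖a k‖)
    (hap : Summable fun k => ‖latticePoint k‖ ^ t * ‖a k‖)
    (haK : ∑' k, ‖latticePoint k‖ ^ t * ‖a k‖ ≤ K)
    (hf : ∀ i, (f (x i) : ℂ) = ∑' k, a k * fourierChar k (x i)) (hfK : ∀ i, |f (x i)| ≤ K)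
    (hemp' : ∀ k, ‖empCoeff n x (fun i => (f (x i) : ℂ) / (g (x i) : ℂ)) k - a k‖ ≤
      K * r * freqWeight c k) :
    (∀ i, 1 / (2 * K) ≤ ‖densityEst Λ c n x (x i)‖) ∧
      ∀ j, ‖smoothingError Λ c n x f j‖ ≤ 15 * K ^ 8 * v := by
  have hK0 : 0 < K := by linarith
  have hsM : 1 ≤ √M := by rwa [Real.one_le_sqrt]
  have hsM2 : √M * √M = M := Real.mul_self_sqrt (by linarith)
  have hct0 : 0 < c ^ t := Real.rpow_pos_of_pos hc t
  have hv : 0 ≤ v := by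
    have : 0 < K * v := hct0.trans_le hct
    exact (pos_of_mul_pos_right this (by linarith)).le
  have hρ : ∀ i, ‖densityEst Λ c n x (x i) - g (x i)‖ * √M ≤ 3 * K ^ 3 * v := fun i => by
    rw [hg]
    exact norm_densityEst_sub_mul_sqrt_le hΛ1 hc hs ht hK hM hr hmass hcM hct hrM hγ hγp hγK hemp _
  have hρ1 : ∀ i, ‖densityEst Λ c n x (x i) - g (x i)‖ ≤ 3 * K ^ 3 * v := fun i =>
    (le_mul_of_one_le_right (norm_nonneg _) hsM).trans (hρ i)
  have hlow : ∀ i, 1 / (2 * K) ≤ ‖densityEst Λ c n x (x i)‖ := by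
    intro i
    have h1 : 3 * K ^ 3 * v ≤ 1 / (2 * K) := by
      rw [le_div_iff₀ (by positivity)]
      nlinarith
    have h2 := norm_le_norm_add_norm_sub' (g (x i) : ℂ) (densityEst Λ c n x (x i))
    rw [norm_sub_rev, Complex.norm_real, Real.norm_eq_abs] at h2
    have h3 := (hgK i).trans (le_abs_self _)
    have h4 : 1 / K = 1 / (2 * K) + 1 / (2 * K) := by field_simp; norm_num
    linarith [hρ1 i]
  refine ⟨hlow, fun j => ?_⟩
  set u : ℕ → ℂ := fun i => (f (x i) : ℂ) / densityEst Λ c n x (x i) with hu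
  set u' : ℕ → ℂ := fun i => (f (x i) : ℂ) / (g (x i) : ℂ) with hu'
  have hsplit : smoothingError Λ c n x f j =
      smoother Λ c n x (fun i => u i - u' i) (x j) +
        (smoother Λ c n x u' (x j) - ∑' k, a k * fourierChar k (x j)) := by
    rw [smoothingError, ← hf]
    simp only [smoother, sub_mul, Finset.sum_sub_distrib, mul_sub]
    ring
  have hb1 : ‖smoother Λ c n x u' (x j) - ∑' k, a k * fourierChar k (x j)‖ ≤ 3 * K ^ 3 * v := by
    refine (norm_smoother_sub_tsum_le hΛ1 hc hs ht hemp' ha hap (x j)).trans ?_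
    have h5 : r * M ≤ K * v := (le_mul_of_one_le_right (by positivity) hsM).trans hrM
    calc K * r * kernelMass Λ c + 2 * c ^ t * ∑' k, ‖latticePoint k‖ ^ t * ‖a k‖
        ≤ K * r * (K * M) + 2 * c ^ t * K := by gcongr
      _ = K ^ 2 * (r * M) + 2 * K * c ^ t := by ring
      _ ≤ K ^ 2 * (K * v) + 2 * K * (K * v) := by gcongr
      _ ≤ 3 * K ^ 3 * v := by
        have : K ^ 2 * v ≤ K ^ 3 * v := by gcongr; norm_num
        nlinarith
  have hQ := mean_norm_smoothingWeight_sq_le hΛ1 hs (by positivity) hemp hγ (x j)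
  have hQ2 : (∑' k, ‖γ k‖) * kernelMass Λ c + K * r * kernelMass Λ c ^ 2 ≤ (2 * K ^ 2) ^ 2 * M := by
    have h0 : 0 ≤ kernelMass Λ c := kernelMass_nonneg
    have h5 : r * M ≤ K := (le_mul_of_one_le_right (by positivity) hsM).trans
      (hrM.trans (mul_le_of_le_one_right hK0.le hv1))
    calc (∑' k, ‖γ k‖) * kernelMass Λ c + K * r * kernelMass Λ c ^ 2
        ≤ K * (K * M) + K * r * (K * M) ^ 2 := by gcongr
      _ = K ^ 2 * M + K ^ 3 * (r * M) * M := by ring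
      _ ≤ K ^ 2 * M + K ^ 3 * K * M := by gcongr
      _ ≤ K ^ 4 * M + K ^ 3 * K * M := by
        gcongr
        norm_num
      _ ≤ (2 * K ^ 2) ^ 2 * M := by nlinarith [show 0 ≤ K ^ 4 * M by positivity]
  have hdiff : ∀ i < n, ‖u i - u' i‖ ≤ 6 * K ^ 6 * v / √M := by
    intro i _
    have hd0 : densityEst Λ c n x (x i) ≠ 0 := by
      intro h
      have := hlow i
      rw [h, norm_zero] at this
      have h7 : 0 < 1 / (2 * K) := by positivity
      linarith
    have hg0 : 0 < g (x i) := (by positivity : 0 < 1 / K).trans_le (hgK i)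
    have hg0' : (g (x i) : ℂ) ≠ 0 := by exact_mod_cast hg0.ne'
    have h6 : u i - u' i = (f (x i) : ℂ) * -(densityEst Λ c n x (x i) - g (x i)) *
        (densityEst Λ c n x (x i))⁻¹ * (g (x i) : ℂ)⁻¹ := by
      simp only [hu, hu']
      field_simp
      ring
    have hinv1 : ‖(densityEst Λ c n x (x i))⁻¹‖ ≤ 2 * K := by
      rw [norm_inv]
      have := inv_anti₀ (by positivity) (hlow i)
      simpa using this
    have hinv2 : ‖(g (x i) : ℂ)⁻¹‖ ≤ K := by
      rw [norm_inv, Complex.norm_real, Real.norm_of_nonneg hg0.le]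
      have := inv_anti₀ (by positivity) (hgK i)
      simpa using this
    have h8 : ‖densityEst Λ c n x (x i) - g (x i)‖ ≤ 3 * K ^ 3 * v / √M := by
      rw [le_div_iff₀ (by positivity)]
      exact hρ i
    rw [h6, norm_mul, norm_mul, norm_mul, norm_neg, Complex.norm_real, Real.norm_eq_abs]
    calc _ ≤ K * (3 * K ^ 3 * v / √M) * (2 * K) * K := by gcongr; exact hfK i
      _ = _ := by ring
  have hb2 := norm_smoother_le (Λ := Λ) (c := c) hn (by positivity) hdiff (x j) (hQ.trans hQ2)
  rw [Real.sqrt_mul (by positivity), Real.sqrt_sq (by positivity)] at hb2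
  have h9 : 6 * K ^ 6 * v / √M * (2 * K ^ 2 * √M) = 12 * K ^ 8 * v := by
    field_simp
    ring
  rw [h9] at hb2
  rw [hsplit]
  have h10 : K ^ 3 * v ≤ K ^ 8 * v := by
    gcongr
    norm_num
  refine (norm_add_le _ _).trans ?_
  linarith

/-- The residual variance against the mean squared error, for one sample. Both the mean square
of the estimation error and its empirical correlation with the errors are of order `v²`. -/
lemma abs_sigmaHat_sq_sub_le {K M r v : ℝ} (hn : 1 ≤ n)
    (hs : Summable fun k : Fin m → ℤ => |Λ (c • latticePoint k)| * freqWeight c k ^ 2)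
    (hK : 1 ≤ K) (hM : 1 ≤ M) (hr : 0 ≤ r) (hv : 0 ≤ v)
    (hmass : kernelMass Λ c ≤ K * M) (hrM : r * M ≤ K * v) (hrv : r ≤ K * v)
    {f : EuclideanSpace ℝ (Fin m) → ℝ} {e y : ℕ → ℝ} (hy : ∀ i, y i = f (x i) + e i)
    (hd : ∀ j, ‖smoothingError Λ c n x f j‖ ≤ 15 * K ^ 8 * v)
    (he : ∀ k, ‖empCoeff n x (fun i => (e i : ℂ)) k‖ ≤ K * r * freqWeight c k)
    (heg : ∀ k, ‖empCoeff n x (fun i => (e i : ℂ) / densityEst Λ c n x (x i)) k‖ ≤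
      K * r * freqWeight c k)
    (hed : ‖(1 / (n : ℂ)) * ∑ j ∈ Finset.range n, (e j : ℂ) * smoothingError Λ c n x f j‖ ≤
      K * r * v) :
    |sigmaHat Λ c n x y ^ 2 - (1 / (n : ℝ)) * ∑ j ∈ Finset.range n, e j ^ 2| ≤
      260 * K ^ 16 * v ^ 2 := by
  have hn' : (0 : ℝ) < n := by exact_mod_cast hn
  have hK0 : 0 < K := by linarith
  set s : ℕ → ℂ := fun j =>
    smoother Λ c n x (fun i => (e i : ℂ) / densityEst Λ c n x (x i)) (x j) with hsdef
  set D : ℕ → ℂ := fun j => s j + smoothingError Λ c n x f j with hD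
  have hres : ∀ j, regressionResidual Λ c n x y j = (e j : ℂ) - D j := by
    intro j
    have h1 : regressionEst Λ c n x y (x j) = s j +
        smoother Λ c n x (fun i => (f (x i) : ℂ) / densityEst Λ c n x (x i)) (x j) := by
      rw [regressionEst_eq_smoother (summable_abs_of_kernelMass hs)]
      simp only [hsdef, smoother, ← mul_add, ← Finset.sum_add_distrib]
      congr 1
      refine Finset.sum_congr rfl fun i _ => ?_
      rw [hy]
      push_cast
      ring
    rw [regressionResidual, h1, hD]
    simp only [smoothingError, hy]
    push_cast
    ring
  have hsb : ∀ j, ‖s j‖ ≤ K ^ 3 * v := by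
    intro j
    simp only [hsdef]
    rw [smoother_eq_tsum (summable_abs_of_kernelMass hs)]
    refine (norm_tsum_kernel_le hs heg (x j)).2.trans ?_
    calc K * r * kernelMass Λ c ≤ K * r * (K * M) := by gcongr
      _ = K ^ 2 * (r * M) := by ring
      _ ≤ K ^ 2 * (K * v) := by gcongr
      _ = K ^ 3 * v := by ring
  have hDb : ∀ j, ‖D j‖ ≤ 16 * K ^ 8 * v := by
    intro j
    have h1 : K ^ 3 * v ≤ K ^ 8 * v := by
      gcongr
      norm_num
    refine (norm_add_le _ _).trans ?_
    linarith [hsb j, hd j]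
  have hsq : sigmaHat Λ c n x y ^ 2 =
      (1 / (n : ℝ)) * ∑ j ∈ Finset.range n, ‖(e j : ℂ) - D j‖ ^ 2 := by
    rw [sigmaHat, Real.sq_sqrt (by positivity)]
    simp only [hres]
  -- Only the real part of `D` correlates with the errors.
  have hexp : ∀ j, ‖(e j : ℂ) - D j‖ ^ 2 = e j ^ 2 - 2 * ((e j : ℂ) * D j).re + ‖D j‖ ^ 2 := by
    intro j
    rw [← Complex.normSq_eq_norm_sq, ← Complex.normSq_eq_norm_sq, Complex.normSq_apply,
      Complex.normSq_apply]
    simp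
    ring
  have hdecomp : sigmaHat Λ c n x y ^ 2 - (1 / (n : ℝ)) * ∑ j ∈ Finset.range n, e j ^ 2 =
      (1 / (n : ℝ)) * ∑ j ∈ Finset.range n, ‖D j‖ ^ 2 -
        2 * ((1 / (n : ℂ)) * ∑ j ∈ Finset.range n, (e j : ℂ) * D j).re := by
    have h1 : ((1 / (n : ℂ)) * ∑ j ∈ Finset.range n, (e j : ℂ) * D j).re =
        (1 / (n : ℝ)) * ∑ j ∈ Finset.range n, ((e j : ℂ) * D j).re := by
      rw [← Complex.re_sum, ← Complex.re_ofReal_mul]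
      push_cast
      rfl
    rw [hsq, h1]
    simp only [hexp, Finset.sum_add_distrib, Finset.sum_sub_distrib, ← Finset.mul_sum]
    ring
  have hA : (1 / (n : ℝ)) * ∑ j ∈ Finset.range n, ‖D j‖ ^ 2 ≤ 256 * K ^ 16 * v ^ 2 := by
    have h1 : ∑ j ∈ Finset.range n, ‖D j‖ ^ 2 ≤ n * (16 * K ^ 8 * v) ^ 2 := by
      have := Finset.sum_le_card_nsmul (Finset.range n) (fun j => ‖D j‖ ^ 2)
        ((16 * K ^ 8 * v) ^ 2) fun j _ => by
          have := hDb j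
          gcongr
      simpa using this
    calc _ ≤ (1 / (n : ℝ)) * (n * (16 * K ^ 8 * v) ^ 2) := by gcongr
      _ = 256 * K ^ 16 * v ^ 2 := by field_simp; ring
  have hA0 : 0 ≤ (1 / (n : ℝ)) * ∑ j ∈ Finset.range n, ‖D j‖ ^ 2 := by positivity
  have hB : ‖(1 / (n : ℂ)) * ∑ j ∈ Finset.range n, (e j : ℂ) * D j‖ ≤ 2 * K ^ 16 * v ^ 2 := by
    have h1 : (1 / (n : ℂ)) * ∑ j ∈ Finset.range n, (e j : ℂ) * D j =
        (1 / (n : ℂ)) * ∑ j ∈ Finset.range n, (e j : ℂ) * s j +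
        (1 / (n : ℂ)) * ∑ j ∈ Finset.range n, (e j : ℂ) * smoothingError Λ c n x f j := by
      rw [← mul_add, ← Finset.sum_add_distrib]
      simp only [hD, mul_add]
    have h2 := norm_mean_mul_smoother_le hs heg he
    have h3 : K * r * (K * r) * kernelMass Λ c ≤ K ^ 16 * v ^ 2 := by
      calc K * r * (K * r) * kernelMass Λ c ≤ K * r * (K * r) * (K * M) := by gcongr
        _ = K ^ 3 * r * (r * M) := by ring
        _ ≤ K ^ 3 * (K * v) * (K * v) := by gcongr
        _ = K ^ 5 * v ^ 2 := by ring
        _ ≤ K ^ 16 * v ^ 2 := by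
          gcongr
          norm_num
    have h4 : K * r * v ≤ K ^ 16 * v ^ 2 := by
      calc K * r * v ≤ K * (K * v) * v := by gcongr
        _ = K ^ 2 * v ^ 2 := by ring
        _ ≤ K ^ 16 * v ^ 2 := by
          gcongr
          norm_num
    rw [h1]
    refine (norm_add_le _ _).trans ?_
    linarith
  rw [hdecomp]
  have hre := (Complex.abs_re_le_norm _).trans hB
  rw [abs_le] at hre ⊢
  constructor
  · linarith [hre.2, show 0 ≤ K ^ 16 * v ^ 2 by positivity]
  · linarith [hre.1]

end OneSample

/-! ### Rates -/

/-- The logarithmic factors are absorbed into `log n` times the weight, as soon as `c ≥ 1 / n`. -/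
lemma log_add_log_le_freqWeight {m n : ℕ} {c : ℝ} (hn : 3 ≤ n) (hc : 1 / (n : ℝ) ≤ c)
    (k : Fin m → ℤ) :
    Real.log n + Real.log (2 + ‖latticePoint k‖) ≤ 4 * Real.log n * freqWeight c k := by
  have hn' : (3 : ℝ) ≤ n := by exact_mod_cast hn
  have hn0 : (0 : ℝ) < n := by linarith
  have hc0 : 0 < c := (by positivity : 0 < 1 / (n : ℝ)).trans_le hc
  have hl1 : 1 ≤ Real.log n := by
    rw [Real.le_log_iff_exp_le hn0]
    linarith [Real.exp_one_lt_d9]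
  set y := ‖c • latticePoint k‖ with hy
  have hy0 : 0 ≤ y := norm_nonneg _
  have hyk : ‖latticePoint k‖ ≤ n * y := by
    rw [hy, norm_smul, Real.norm_of_nonneg hc0.le, ← mul_assoc]
    refine le_mul_of_one_le_left (norm_nonneg _) ?_
    rwa [div_le_iff₀' hn0] at hc
  have h1 : Real.log (2 + ‖latticePoint k‖) ≤ Real.log n + Real.log (2 + y) := by
    rw [← Real.log_mul hn0.ne' (by positivity)]
    apply Real.log_le_log (by positivity)
    nlinarith
  have h2 : Real.log (2 + y) ≤ 2 * freqWeight c k := by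
    have h3 : Real.log (2 + y) = 2 * Real.log (√(2 + y)) := by
      rw [Real.log_sqrt (by positivity)]
      ring
    have h4 := Real.log_le_sub_one_of_pos (Real.sqrt_pos.2 (by positivity : 0 < 2 + y))
    have h5 : √(2 + y) ≤ freqWeight c k + 1 := by
      rw [Real.sqrt_le_left (by linarith [one_le_freqWeight c k])]
      have h6 := freqWeight_sq c k
      rw [← hy] at h6
      nlinarith [one_le_freqWeight c k]
    linarith
  have hw := one_le_freqWeight c k
  nlinarith

/-- The kernel mass is of the order `c^{-m}` of the number of frequencies `k` with `‖c k‖ ≤ 1`. -/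
lemma kernelMass_le {m : ℕ} {Λ : EuclideanSpace ℝ (Fin m) → ℝ} {c B : ℝ} (hΛ1 : IsFourierKernel Λ)
    (hc : 0 < c) (hc1 : c ≤ 1)
    (hs : Summable fun k : Fin m → ℤ => ‖c • latticePoint k‖ * |Λ (c • latticePoint k)|)
    (hB : c ^ m * ∑' k : Fin m → ℤ, ‖c • latticePoint k‖ * |Λ (c • latticePoint k)| ≤ B) :
    (Summable fun k : Fin m → ℤ => |Λ (c • latticePoint k)| * freqWeight c k ^ 2) ∧
      kernelMass Λ c ≤ (2 * 3 ^ m + 2 * B) * (c ^ m)⁻¹ := by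
  classical
  set N : ℤ := ⌊1 / c⌋ with hN
  have hN0 : 0 ≤ N := Int.floor_nonneg.2 (by positivity)
  -- The frequencies with `‖c k‖ ≤ 1` lie in the box of half-width `⌊1/c⌋`.
  set S : Finset (Fin m → ℤ) := Fintype.piFinset fun _ => Finset.Icc (-N) N with hS
  have hle : ∀ k : Fin m → ℤ, |Λ (c • latticePoint k)| * freqWeight c k ^ 2 ≤
      (if k ∈ S then 2 else 0) + 2 * (‖c • latticePoint k‖ * |Λ (c • latticePoint k)|) := by
    intro k
    rw [freqWeight_sq]
    have hΛ0 := abs_nonneg (Λ (c • latticePoint k))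
    rcases le_or_gt ‖c • latticePoint k‖ 1 with h | h
    · have hk : k ∈ S := by
        rw [hS, Fintype.mem_piFinset]
        intro i
        rw [norm_smul, Real.norm_of_nonneg hc.le] at h
        have h1 : |(k i : ℝ)| ≤ 1 / c := by
          rw [le_div_iff₀' hc]
          refine le_trans ?_ h
          gcongr
          exact PiLp.norm_apply_le (latticePoint k) i
        have h2 : |k i| ≤ N := Int.le_floor.2 (by exact_mod_cast h1)
        rw [Finset.mem_Icc]
        exact abs_le.1 h2
      rw [if_pos hk, hΛ1.eq_one _ h]
      simp only [abs_one, one_mul]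
      linarith [norm_nonneg (c • latticePoint k)]
    · have h3 : (0 : ℝ) ≤ if k ∈ S then 2 else 0 := by split_ifs <;> norm_num
      nlinarith
  have hfin : HasSum (fun k : Fin m → ℤ => if k ∈ S then (2 : ℝ) else 0) (∑ _k ∈ S, (2 : ℝ)) := by
    have h4 : ∑ k ∈ S, (if k ∈ S then (2 : ℝ) else 0) = ∑ _k ∈ S, (2 : ℝ) :=
      Finset.sum_congr rfl fun k hk => if_pos hk
    rw [← h4]
    exact hasSum_sum_of_ne_finset_zero fun k hk => if_neg hk
  have hsum := hfin.summable.add (hs.mul_left 2)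
  have hres := Summable.of_nonneg_of_le
    (fun k => mul_nonneg (abs_nonneg (Λ (c • latticePoint k))) (sq_nonneg (freqWeight c k)))
    hle hsum
  refine ⟨hres, (hres.tsum_le_tsum hle hsum).trans ?_⟩
  rw [hfin.summable.tsum_add (hs.mul_left 2), hfin.tsum_eq, tsum_mul_left]
  have hcm : 0 < c ^ m := by positivity
  have hcard : (∑ _k ∈ S, (2 : ℝ)) ≤ 2 * 3 ^ m * (c ^ m)⁻¹ := by
    rw [Finset.sum_const, hS, Fintype.card_piFinset_const, Int.card_Icc, nsmul_eq_mul, mul_comm,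
      mul_assoc, ← inv_pow, ← mul_pow]
    gcongr
    rw [Nat.cast_pow]
    gcongr
    have h5 : ((N + 1 - -N).toNat : ℝ) = 2 * N + 1 := by
      have : ((N + 1 - -N).toNat : ℤ) = 2 * N + 1 := by omega
      exact_mod_cast this
    have h6 : (N : ℝ) ≤ c⁻¹ := by
      rw [← one_div]
      exact Int.floor_le _
    have h7 : 1 ≤ c⁻¹ := (one_le_inv₀ hc).2 hc1
    rw [h5]
    linarith
  have hB' : ∑' k : Fin m → ℤ, ‖c • latticePoint k‖ * |Λ (c • latticePoint k)| ≤ B * (c ^ m)⁻¹ := by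
    rw [← div_eq_mul_inv, le_div_iff₀' hcm]
    exact hB
  rw [add_mul]
  linarith

/-- The bounds at sample size `n` on which the one-sample estimates rest: `t` is the smoothness of
the distorted regression function, `v` the target rate and `K` a constant. -/
structure RateBounds {m : ℕ} (Λ : EuclideanSpace ℝ (Fin m) → ℝ) (c : ℝ) (n : ℕ) (t v K : ℝ) :
    Prop where
  three_le : 3 ≤ n
  inv_le : 1 / (n : ℝ) ≤ c
  v_pos : 0 < v
  v_le_one : v ≤ 1
  summable : Summable fun k : Fin m → ℤ => |Λ (c • latticePoint k)| * freqWeight c k ^ 2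
  mass_le : kernelMass Λ c ≤ K * (c ^ m)⁻¹
  rpow_le : c ^ t ≤ K * v
  rate_le : Real.log n / √n * (c ^ m)⁻¹ * √((c ^ m)⁻¹) ≤ K * v

lemma RateBounds.mono {m : ℕ} {Λ : EuclideanSpace ℝ (Fin m) → ℝ} {c : ℝ} {n : ℕ} {t v K K' : ℝ}
    (h : RateBounds Λ c n t v K) (hK : K ≤ K') : RateBounds Λ c n t v K' := by
  have hc : 0 < c := by
    have : 3 ≤ n := h.three_le
    exact (by positivity : 0 < 1 / (n : ℝ)).trans_le h.inv_le
  have h1 : K * v ≤ K' * v := mul_le_mul_of_nonneg_right hK h.v_pos.le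
  exact ⟨h.three_le, h.inv_le, h.v_pos, h.v_le_one, h.summable,
    h.mass_le.trans (mul_le_mul_of_nonneg_right hK (by positivity)), h.rpow_le.trans h1,
    h.rate_le.trans h1⟩

/-- With `c` of the exact order `(log n / n)^q`, `q = 1 / (2t + 3m)`, the bias `c^t` and the
stochastic rate `c^{-3m/2} n^{-1/2}` balance at `n^{-tq}` up to logarithms, and `t > 3m/2` means
`tq > 1/4`. -/
lemma exists_rateBounds {m : ℕ} (hm : 1 ≤ m) {Λ : EuclideanSpace ℝ (Fin m) → ℝ} {c : ℕ → ℝ}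
    {t : ℝ} (hc : ∀ n, 0 < c n) (hΛ1 : IsFourierKernel Λ) (hR : BoundedRiemannSums Λ c)
    (ht : 3 * (m : ℝ) / 2 < t)
    (hcΘ : c =Θ[atTop] fun n : ℕ =>
      (n : ℝ) ^ (-(1 / (2 * t + 3 * m))) * Real.log n ^ (1 / (2 * t + 3 * m))) :
    ∃ (K : ℝ) (v : ℕ → ℝ), 0 ≤ K ∧ Tendsto v atTop (nhds 0) ∧
      ((fun n => v n ^ 2) =o[atTop] fun n : ℕ => (n : ℝ) ^ (-(1 / 2 : ℝ))) ∧
      ∀ᶠ n in atTop, RateBounds Λ (c n) n t (v n) K := by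
  have hm' : (1 : ℝ) ≤ m := by exact_mod_cast hm
  have ht0 : 0 < t := by linarith
  set q : ℝ := 1 / (2 * t + 3 * m) with hq
  have hden : 0 < 2 * t + 3 * m := by linarith
  have hq0 : 0 < q := by positivity
  have hq1 : q < 1 := by
    rw [hq, div_lt_one hden]
    linarith
  have hqt : 2 * (q * t) + 3 * (m * q) = 1 := by
    rw [hq]
    field_simp
  have hqt4 : 1 / 4 < q * t := by nlinarith
  -- Half of the excess of `q t` over `1/4` absorbs the logarithms, the other half beats `n^{-1/4}`.
  set δ : ℝ := (q * t - 1 / 4) / 2 with hδ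
  have hδ0 : 0 < δ := by rw [hδ]; linarith
  set v : ℕ → ℝ := fun n => (n : ℝ) ^ (-(1 / 4 + δ)) with hv
  obtain ⟨C1, hC1, h1⟩ := hcΘ.1.exists_pos
  obtain ⟨C2, hC2, h2⟩ := hcΘ.2.exists_pos
  obtain ⟨B, hB⟩ := hR
  have hvt : Tendsto v atTop (nhds 0) :=
    (tendsto_rpow_neg_atTop (by linarith)).comp tendsto_natCast_atTop_atTop
  have hlog : ∀ p : ℝ, ∀ᶠ n : ℕ in atTop, Real.log n ^ p ≤ (n : ℝ) ^ δ := by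
    intro p
    have h3 := (isLittleO_log_rpow_rpow_atTop p hδ0).comp_tendsto tendsto_natCast_atTop_atTop
    filter_upwards [h3.bound one_pos, eventually_ge_atTop 1] with n hn hn1
    have hn1' : (1 : ℝ) ≤ n := by exact_mod_cast hn1
    simp only [Function.comp, one_mul] at hn
    rw [Real.norm_of_nonneg (Real.rpow_nonneg (Real.log_nonneg hn1') _),
      Real.norm_of_nonneg (by positivity)] at hn
    exact hn
  set K1 : ℝ := C1 ^ t with hK1
  set K2 : ℝ := C2 ^ (3 * (m : ℝ) / 2) with hK2
  have hKv : ∀ᶠ n in atTop, K1 * v n ≤ 1 := by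
    have h4 : Tendsto (fun n => K1 * v n) atTop (nhds 0) := by simpa using hvt.const_mul K1
    exact h4.eventually_le_const one_pos
  have hnq : ∀ᶠ n : ℕ in atTop, C2 ≤ (n : ℝ) ^ (1 - q) :=
    ((tendsto_rpow_atTop (by linarith : 0 < 1 - q)).comp
      tendsto_natCast_atTop_atTop).eventually_ge_atTop C2
  refine ⟨|2 * 3 ^ m + 2 * B| + K1 + K2, v, by positivity, hvt, ?_, ?_⟩
  · have h5 : (fun n : ℕ => v n ^ 2) =ᶠ[atTop] fun n : ℕ => (n : ℝ) ^ (-(1 / 2 : ℝ) - 2 * δ) := by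
      filter_upwards with n
      rw [hv]
      simp only
      rw [← Real.rpow_natCast, ← Real.rpow_mul (Nat.cast_nonneg n)]
      congr 1
      push_cast
      ring
    refine IsLittleO.congr' ?_ h5.symm EventuallyEq.rfl
    have h6 : Tendsto (fun n : ℕ => (n : ℝ) ^ (-(2 * δ))) atTop (nhds 0) :=
      (tendsto_rpow_neg_atTop (by linarith)).comp tendsto_natCast_atTop_atTop
    refine isLittleO_of_tendsto' ?_ (h6.congr' ?_)
    · filter_upwards [eventually_ge_atTop 1] with n hn h0
      have hn' : (0 : ℝ) < n := by exact_mod_cast hn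
      exact absurd h0 (by positivity)
    · filter_upwards [eventually_ge_atTop 1] with n hn
      have hn' : (0 : ℝ) < n := by exact_mod_cast hn
      rw [← Real.rpow_sub hn']
      congr 1
      ring
  · filter_upwards [h1.bound, h2.bound, hB, hlog (q * t), hlog 1, hKv, hnq,
      hvt.eventually_le_const one_pos, eventually_ge_atTop 3] with n h1 h2 hBn hl1 hl2 hKv hnq hv1 hn3
    have hn3' : (3 : ℝ) ≤ n := by exact_mod_cast hn3
    have hn0 : (0 : ℝ) < n := by linarith
    have hL1 : 1 ≤ Real.log n := by
      rw [Real.le_log_iff_exp_le hn0]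
      linarith [Real.exp_one_lt_d9]
    have hu0 : 0 < (n : ℝ) ^ (-q) * Real.log n ^ q := by positivity
    have hcn := hc n
    rw [Real.norm_of_nonneg hcn.le, Real.norm_of_nonneg hu0.le] at h1 h2
    have hvpos : 0 < v n := by positivity
    have hsplitv : (n : ℝ) ^ (-(q * t)) * (n : ℝ) ^ δ = v n := by
      rw [hv, ← Real.rpow_add hn0]
      congr 1
      rw [hδ]
      ring
    have hct : c n ^ t ≤ K1 * v n := by
      calc c n ^ t ≤ (C1 * ((n : ℝ) ^ (-q) * Real.log n ^ q)) ^ t := by gcongr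
        _ = K1 * ((n : ℝ) ^ (-(q * t)) * Real.log n ^ (q * t)) := by
          rw [Real.mul_rpow hC1.le hu0.le, Real.mul_rpow (by positivity) (by positivity),
            ← Real.rpow_mul hn0.le, ← Real.rpow_mul (by linarith), neg_mul]
        _ ≤ K1 * ((n : ℝ) ^ (-(q * t)) * (n : ℝ) ^ δ) := by gcongr
        _ = K1 * v n := by rw [hsplitv]
    have hc1 : c n ≤ 1 := by
      by_contra! hcon
      have := Real.one_lt_rpow hcon ht0
      linarith
    have hinv : (c n)⁻¹ ≤ C2 * (n : ℝ) ^ q := by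
      have h7 : (n : ℝ) ^ (-q) ≤ C2 * c n := by
        refine le_trans ?_ h2
        exact le_mul_of_one_le_right (by positivity) (Real.one_le_rpow hL1 hq0.le)
      rw [Real.rpow_neg hn0.le, inv_le_iff_one_le_mul₀ (by positivity)] at h7
      rw [inv_le_iff_one_le_mul₀ hcn]
      linarith
    have hninv : 1 / (n : ℝ) ≤ c n := by
      rw [one_div, inv_le_comm₀ hn0 hcn]
      calc (c n)⁻¹ ≤ C2 * (n : ℝ) ^ q := hinv
        _ ≤ (n : ℝ) ^ (1 - q) * (n : ℝ) ^ q := by gcongr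
        _ = n := by
          rw [← Real.rpow_add hn0]
          simp
    obtain ⟨hs, hmass⟩ := kernelMass_le hΛ1 hcn hc1 hBn.1 hBn.2
    have hrate : Real.log n / √n * (c n ^ m)⁻¹ * √((c n ^ m)⁻¹) ≤ K2 * v n := by
      have h8 : (c n ^ m)⁻¹ * √((c n ^ m)⁻¹) = (c n)⁻¹ ^ (3 * (m : ℝ) / 2) := by
        have hci : 0 < (c n)⁻¹ := by positivity
        rw [← inv_pow, Real.sqrt_eq_rpow, ← Real.rpow_natCast, ← Real.rpow_mul hci.le,
          ← Real.rpow_add hci]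
        congr 1
        ring
      have h9 : Real.log n / √n = Real.log n * (n : ℝ) ^ (-(1 / 2 : ℝ)) := by
        rw [Real.sqrt_eq_rpow, Real.rpow_neg hn0.le, div_eq_mul_inv]
      rw [mul_assoc, h8, h9]
      calc Real.log n * (n : ℝ) ^ (-(1 / 2 : ℝ)) * (c n)⁻¹ ^ (3 * (m : ℝ) / 2)
          ≤ (n : ℝ) ^ δ * (n : ℝ) ^ (-(1 / 2 : ℝ)) * (C2 * (n : ℝ) ^ q) ^ (3 * (m : ℝ) / 2) := by
            rw [Real.rpow_one] at hl2
            gcongr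
        _ = K2 * ((n : ℝ) ^ (-(1 / 2 : ℝ)) * (n : ℝ) ^ (q * (3 * (m : ℝ) / 2)) * (n : ℝ) ^ δ) := by
            rw [Real.mul_rpow hC2.le (by positivity), ← Real.rpow_mul hn0.le]
            ring
        _ = K2 * v n := by
            rw [← Real.rpow_add hn0, ← hsplitv]
            congr 4
            linarith
    have hK2 : 0 < K2 := by positivity
    have hK1 : 0 < K1 := by positivity
    refine ⟨hn3, hninv, hvpos, hv1, hs, hmass.trans ?_, hct.trans ?_, hrate.trans ?_⟩
    · refine mul_le_mul_of_nonneg_right ?_ (by positivity)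
      linarith [le_abs_self (2 * 3 ^ m + 2 * B)]
    · refine mul_le_mul_of_nonneg_right ?_ hvpos.le
      linarith [abs_nonneg (2 * 3 ^ m + 2 * B)]
    · refine mul_le_mul_of_nonneg_right ?_ hvpos.le
      linarith [abs_nonneg (2 * 3 ^ m + 2 * B)]

/-! ### The distorted regression function and the design density -/

lemma summable_norm_of_summable_rpow_mul {m : ℕ} {b : (Fin m → ℤ) → ℂ} {p : ℝ} (hp : 0 ≤ p)
    (hb : Summable fun k => ‖latticePoint k‖ ^ p * ‖b k‖) : Summable fun k => ‖b k‖ := by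
  refine Summable.of_norm_bounded_eventually hb ?_
  have h0 : ({0}ᶜ : Set (Fin m → ℤ)) ∈ cofinite := by simp
  filter_upwards [h0] with k hk
  rw [norm_norm]
  exact le_mul_of_one_le_left (norm_nonneg _) (Real.one_le_rpow (one_le_norm_latticePoint hk) hp)

lemma norm_cubeCoeff_le_one {m : ℕ} {ψ : EuclideanSpace ℝ (Fin m) → ℝ} (hψ : IsDistortion ψ)
    (k : Fin m → ℤ) : ‖cubeCoeff ψ k‖ ≤ 1 := by
  rw [← hψ.integral_eq_one, cubeCoeff]
  refine (norm_integral_le_integral_norm _).trans (le_of_eq ?_)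
  refine integral_congr_ae (Eventually.of_forall fun x => ?_)
  simp [norm_fourierChar, abs_of_nonneg (hψ.nonneg x)]

/-- Convolution with `ψ` raises the smoothness of `θ` by the degree of ill-posedness. -/
lemma summable_rpow_mul_cubeCoeff_mul {m : ℕ} {ψ θ : EuclideanSpace ℝ (Fin m) → ℝ} {s b : ℝ}
    (hs : 0 < s) (hθ : MemSmoothClass s θ) (hψ : IsDistortion ψ) (hb : IllPosedOfDegree b ψ) :
    Summable fun k : Fin m → ℤ =>
      ‖latticePoint k‖ ^ (s + b) * ‖cubeCoeff θ k * cubeCoeff ψ k‖ := by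
  obtain ⟨hb0, γ, C, C', hγ, hC, hCC', hk⟩ := hb
  refine Summable.of_nonneg_of_le (fun k => by positivity) (fun k => ?_)
    (hθ.summable.mul_right (C' + γ ^ b))
  rw [Real.rpow_add_of_nonneg (norm_nonneg _) hs.le hb0, norm_mul, mul_mul_mul_comm]
  refine mul_le_mul_of_nonneg_left ?_ (by positivity)
  have hγb : 0 ≤ γ ^ b := by positivity
  rcases lt_or_ge γ ‖latticePoint k‖ with h | h
  · linarith [(hk k h).2]
  · have h1 : ‖latticePoint k‖ ^ b * ‖cubeCoeff ψ k‖ ≤ γ ^ b * 1 := by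
      gcongr
      exact norm_cubeCoeff_le_one hψ k
    linarith

lemma setIntegral_tsum_mul_fourierChar {m : ℕ} {a : (Fin m → ℤ) → ℂ}
    (ha : Summable fun k => ‖a k‖) (k : Fin m → ℤ) :
    ∫ x in unitCube m, (∑' l, a l * fourierChar l x) * fourierChar (-k) x = a k := by
  have := isProbabilityMeasure_restrict_unitCube m
  have h1 : ∀ x, (∑' l, a l * fourierChar l x) * fourierChar (-k) x =
      ∑' l, a l * fourierChar (l - k) x := by
    intro x
    rw [← tsum_mul_right]
    refine tsum_congr fun l => ?_
    rw [mul_assoc, ← fourierChar_add, sub_eq_add_neg]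
  have hint : ∀ l, Integrable (fun x => a l * fourierChar (l - k) x)
      (volume.restrict (unitCube m)) := fun l =>
    Integrable.of_bound (continuous_const.mul (continuous_fourierChar _)).aestronglyMeasurable ‖a l‖
      (Eventually.of_forall fun x => by simp [norm_fourierChar])
  simp only [h1]
  rw [← integral_tsum_of_summable_integral_norm hint (by simpa [norm_fourierChar] using ha)]
  simp only [integral_const_mul, setIntegral_fourierChar, sub_eq_zero]
  simp

/-! ### Almost sure bounds along the design -/

section Design

variable {Ω : Type*} [MeasurableSpace Ω] {μ : Measure Ω} {m : ℕ}
  {X : ℕ → Ω → EuclideanSpace ℝ (Fin m)} {g : EuclideanSpace ℝ (Fin m) → ℝ}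

lemma ae_forall_design_of_ae (hX_meas : ∀ j, Measurable (X j))
    (hX_ident : ∀ j, IdentDistrib (X j) (X 0) μ μ)
    (hlaw : μ.map (X 0) =
      (volume.restrict (unitCube m)).withDensity (fun x => ENNReal.ofReal (g x)))
    {P : EuclideanSpace ℝ (Fin m) → Prop} (hP : ∀ᵐ x ∂(volume.restrict (unitCube m)), P x) :
    ∀ᵐ ω ∂μ, ∀ j, P (X j ω) := by
  rw [ae_all_iff]
  intro j
  refine ae_of_ae_map (hX_meas j).aemeasurable ?_
  rw [(hX_ident j).map_eq, hlaw]
  exact (withDensity_absolutelyContinuous _ _).ae_le hP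

lemma integral_comp_design (hX_meas : Measurable (X 0))
    (hg : AEMeasurable g (volume.restrict (unitCube m)))
    (hg0 : ∀ᵐ x ∂(volume.restrict (unitCube m)), 0 ≤ g x)
    (hlaw : μ.map (X 0) =
      (volume.restrict (unitCube m)).withDensity (fun x => ENNReal.ofReal (g x)))
    {φ : EuclideanSpace ℝ (Fin m) → ℂ} (hφ : Measurable φ) :
    ∫ ω, φ (X 0 ω) ∂μ = ∫ x in unitCube m, (g x : ℂ) * φ x := by
  rw [← integral_map hX_meas.aemeasurable hφ.aestronglyMeasurable, hlaw,
    integral_withDensity_eq_integral_toReal_smul₀ hg.ennreal_ofReal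
      (Eventually.of_forall fun x => ENNReal.ofReal_lt_top)]
  refine integral_congr_ae ?_
  filter_upwards [hg0] with x hx
  rw [ENNReal.toReal_ofReal hx, Complex.real_smul]

end Design

lemma norm_inv_mul_le_freqWeight {m n : ℕ} {c C K : ℝ} {S : ℂ} {k : Fin m → ℤ} (hn : 3 ≤ n)
    (hc : 1 / (n : ℝ) ≤ c) (hC : 0 ≤ C) (hCK : 4 * C ≤ K)
    (hS : ‖S‖ ≤ C * (√n * (Real.log n + Real.log (2 + ‖latticePoint k‖)))) :
    ‖(1 / (n : ℂ)) * S‖ ≤ K * (Real.log n / √n) * freqWeight c k := by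
  have hn' : (3 : ℝ) ≤ n := by exact_mod_cast hn
  have hn0 : (0 : ℝ) < n := by linarith
  have hl : 0 ≤ Real.log n := Real.log_nonneg (by linarith)
  have hw : 0 ≤ freqWeight c k := zero_le_one.trans (one_le_freqWeight c k)
  rw [norm_mul, norm_div, norm_one, Complex.norm_natCast]
  calc 1 / (n : ℝ) * ‖S‖
      ≤ 1 / (n : ℝ) * (C * (√n * (4 * Real.log n * freqWeight c k))) := by
        refine mul_le_mul_of_nonneg_left (hS.trans ?_) (by positivity)
        gcongr
        exact log_add_log_le_freqWeight hn hc k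
    _ = 4 * C * (Real.log n / √n) * freqWeight c k := by
        have hs2 : 1 / (n : ℝ) * √n = 1 / √n := by
          rw [one_div, inv_mul_eq_div, Real.sqrt_div_self']
        rw [show 1 / (n : ℝ) * (C * (√n * (4 * Real.log n * freqWeight c k))) =
          (1 / (n : ℝ) * √n) * (4 * C * Real.log n * freqWeight c k) by ring, hs2]
        ring
    _ ≤ _ := by gcongr

/-- If the kernel is not summable over the lattice, the series defining the weights converges
nowhere and its value is zero by convention. -/
lemma measurable_smoothingWeight {m : ℕ} (Λ : EuclideanSpace ℝ (Fin m) → ℝ) (c : ℝ) :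
    Measurable (smoothingWeight Λ c) := by
  by_cases hs : Summable fun k : Fin m → ℤ => ‖(Λ (c • latticePoint k) : ℂ)‖
  · exact (continuous_tsum_mul_fourierChar hs).measurable
  · have h0 : smoothingWeight Λ c = fun _ => 0 := by
      funext x
      refine tsum_eq_zero_of_not_summable fun h => hs ?_
      simpa only [norm_mul, norm_fourierChar, mul_one] using h.norm
    rw [h0]
    exact measurable_const

lemma measurable_densityEst_design {m : ℕ} (Λ : EuclideanSpace ℝ (Fin m) → ℝ) (c : ℝ) (n i : ℕ) :
    Measurable fun x : ℕ → EuclideanSpace ℝ (Fin m) => densityEst Λ c n x (x i) := by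
  refine (Finset.measurable_sum _ fun j _ => ?_).const_mul _
  exact (measurable_smoothingWeight Λ c).comp ((measurable_pi_apply i).sub (measurable_pi_apply j))

lemma measurable_smoothingError {m : ℕ} (Λ : EuclideanSpace ℝ (Fin m) → ℝ) (c : ℝ) (n j : ℕ)
    {f : EuclideanSpace ℝ (Fin m) → ℝ} (hf : Measurable f) :
    Measurable fun x : ℕ → EuclideanSpace ℝ (Fin m) => smoothingError Λ c n x f j := by
  have hfx : ∀ i, Measurable fun x : ℕ → EuclideanSpace ℝ (Fin m) => (f (x i) : ℂ) := fun i =>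
    Complex.measurable_ofReal.comp (hf.comp (measurable_pi_apply i))
  refine Measurable.sub ((Finset.measurable_sum _ fun i _ => ?_).const_mul _) (hfx j)
  exact ((hfx i).div (measurable_densityEst_design Λ c n i)).mul
    ((measurable_smoothingWeight Λ c).comp ((measurable_pi_apply j).sub (measurable_pi_apply i)))

section Design

variable {Ω : Type*} [MeasurableSpace Ω] {μ : Measure Ω} [IsProbabilityMeasure μ] {m : ℕ}
  {X : ℕ → Ω → EuclideanSpace ℝ (Fin m)} {f g Λ : EuclideanSpace ℝ (Fin m) → ℝ} {c v : ℕ → ℝ}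

/-- Almost surely, the density estimate at the design points is eventually bounded away from zero,
and the noiseless smoothing error is of order `v`. -/
lemma ae_design_bounds {t K₀ : ℝ} (hX_meas : ∀ j, Measurable (X j)) (hX_indep : iIndepFun X μ)
    (hX_ident : ∀ j, IdentDistrib (X j) (X 0) μ μ)
    (hlaw : μ.map (X 0) =
      (volume.restrict (unitCube m)).withDensity (fun x => ENNReal.ofReal (g x)))
    (hΛ1 : IsFourierKernel Λ) (hc : ∀ n, 0 < c n) (ht : 0 < t)
    (hg : IsRegularDensity (t + m) g) {a : (Fin m → ℤ) → ℂ}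
    (hap : Summable fun k => ‖latticePoint k‖ ^ t * ‖a k‖)
    (hf : ∀ x, (f x : ℂ) = ∑' k, a k * fourierChar k x)
    (hv : Tendsto v atTop (nhds 0)) (hrate : ∀ᶠ n in atTop, RateBounds Λ (c n) n t (v n) K₀) :
    ∀ᵐ ω ∂μ, ∃ K : ℕ, 1 ≤ K ∧ ∀ᶠ n in atTop,
      (∀ i, 1 / (2 * (K : ℝ)) ≤ ‖densityEst Λ (c n) n (fun i => X i ω) (X i ω)‖) ∧
      ∀ j, ‖smoothingError Λ (c n) n (fun i => X i ω) f j‖ ≤ 15 * (K : ℝ) ^ 8 * v n := by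
  have hprob := isProbabilityMeasure_restrict_unitCube m
  obtain ⟨α, hα, hgα⟩ := hg.bounded_below
  have hγp := hg.memSmoothClass.summable
  have hγ := summable_norm_of_summable_rpow_mul (by positivity) hγp
  have ha := summable_norm_of_summable_rpow_mul ht.le hap
  have hgG := ae_eq_tsum_cubeCoeff hg.memSmoothClass.memLp hγ
  have hgae : AEMeasurable g (volume.restrict (unitCube m)) :=
    hg.memSmoothClass.memLp.aestronglyMeasurable.aemeasurable
  have hgα' : ∀ᵐ x ∂(volume.restrict (unitCube m)), α ≤ g x := by
    filter_upwards [ae_restrict_mem (measurableSet_unitCube m)] with x hx using hgα x hx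
  have hg0 : ∀ᵐ x ∂(volume.restrict (unitCube m)), 0 ≤ g x := by
    filter_upwards [hgα'] with x hx using hα.le.trans hx
  -- `G` is a measurable version of `g`, bounded below everywhere.
  set G : EuclideanSpace ℝ (Fin m) → ℝ := fun x =>
    max α (∑' k, cubeCoeff g k * fourierChar k x).re with hG
  have hGm : Measurable G :=
    measurable_const.max (Complex.measurable_re.comp (continuous_tsum_mul_fourierChar hγ).measurable)
  have hGg : ∀ᵐ x ∂(volume.restrict (unitCube m)), G x = g x := by
    filter_upwards [hgG, hgα'] with x h1 h2
    rw [hG]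
    simp only
    rw [← h1, Complex.ofReal_re, max_eq_right h2]
  have hfm : Measurable f := by
    have h1 : f = fun x => (∑' k, a k * fourierChar k x).re := by
      funext x
      rw [← hf, Complex.ofReal_re]
    rw [h1]
    exact Complex.measurable_re.comp (continuous_tsum_mul_fourierChar ha).measurable
  have hfb : ∀ x, |f x| ≤ ∑' k, ‖a k‖ := by
    intro x
    have h1 := norm_tsum_mul_fourierChar_le ha x
    rwa [← hf, Complex.norm_real, Real.norm_eq_abs] at h1
  have hfGb : ∀ x, |f x / G x| ≤ (∑' k, ‖a k‖) / α := by
    intro x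
    have h1 : α ≤ G x := le_max_left _ _
    rw [abs_div, abs_of_pos (hα.trans_le h1)]
    gcongr
    exact hfb x
  have hcoef1 : ∀ k : Fin m → ℤ,
      ∫ ω, ((1 : ℝ) : ℂ) * fourierChar (-k) (X 0 ω) ∂μ = cubeCoeff g k := by
    intro k
    rw [integral_comp_design (φ := fun x => ((1 : ℝ) : ℂ) * fourierChar (-k) x) (hX_meas 0) hgae
      hg0 hlaw ((continuous_fourierChar _).measurable.const_mul _)]
    simp [cubeCoeff]
  have hcoef2 : ∀ k : Fin m → ℤ,
      ∫ ω, ((f (X 0 ω) / G (X 0 ω) : ℝ) : ℂ) * fourierChar (-k) (X 0 ω) ∂μ = a k := by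
    intro k
    rw [integral_comp_design (φ := fun x => ((f x / G x : ℝ) : ℂ) * fourierChar (-k) x) (hX_meas 0)
      hgae hg0 hlaw ((Complex.measurable_ofReal.comp (hfm.div hGm)).mul
        (continuous_fourierChar _).measurable), ← setIntegral_tsum_mul_fourierChar ha k]
    refine integral_congr_ae ?_
    filter_upwards [hGg, hgα'] with x h1 h2
    have h3 : (g x : ℂ) ≠ 0 := by exact_mod_cast (hα.trans_le h2).ne'
    rw [h1, ← hf, ← mul_assoc]
    congr 1
    push_cast
    field_simp
  have hT1 := ae_empiricalCoeff_sub_integral_le hX_meas hX_indep hX_ident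
    (h := fun _ => 1) measurable_const (H := 1) (fun x => by simp)
  have hT2 := ae_empiricalCoeff_sub_integral_le hX_meas hX_indep hX_ident
    (h := fun x => f x / G x) (hfm.div hGm) hfGb
  simp only [hcoef1] at hT1
  simp only [hcoef2] at hT2
  have hgood := ae_forall_design_of_ae hX_meas hX_ident hlaw (hgG.and (hGg.and hgα'))
  filter_upwards [hT1, hT2, hgood] with ω h1 h2 h3
  obtain ⟨C1, h1⟩ := h1
  obtain ⟨C2, h2⟩ := h2
  obtain ⟨K, hK⟩ := exists_nat_ge (1 + |K₀| + 4 * |C1| + 4 * |C2| + 1 / α + (∑' k, ‖a k‖) +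
    (∑' k, ‖cubeCoeff g k‖) + (∑' k, ‖latticePoint k‖ ^ (t + m) * ‖cubeCoeff g k‖) +
    ∑' k, ‖latticePoint k‖ ^ t * ‖a k‖)
  have n1 := abs_nonneg K₀
  have n2 := abs_nonneg C1
  have n3 := abs_nonneg C2
  have n4 : 0 < 1 / α := by positivity
  have n5 : 0 ≤ ∑' k, ‖a k‖ := tsum_nonneg fun k => norm_nonneg _
  have n6 : 0 ≤ ∑' k, ‖cubeCoeff g k‖ := tsum_nonneg fun k => norm_nonneg _
  have n7 : 0 ≤ ∑' k, ‖latticePoint k‖ ^ (t + m) * ‖cubeCoeff g k‖ :=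
    tsum_nonneg fun k => by positivity
  have n8 : 0 ≤ ∑' k, ‖latticePoint k‖ ^ t * ‖a k‖ := tsum_nonneg fun k => by positivity
  have hK1 : (1 : ℝ) ≤ K := by linarith
  refine ⟨K, by exact_mod_cast hK1, ?_⟩
  have hvK : ∀ᶠ n in atTop, 6 * (K : ℝ) ^ 4 * v n ≤ 1 := by
    have h4 : Tendsto (fun n => 6 * (K : ℝ) ^ 4 * v n) atTop (nhds 0) := by
      simpa using hv.const_mul (6 * (K : ℝ) ^ 4)
    exact h4.eventually_le_const one_pos
  have hemp : ∀ (n : ℕ) (u : ℕ → ℂ) (E : ℂ) (k : Fin m → ℤ), 3 ≤ n →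
      empCoeff n (fun i => X i ω) u k - E =
        (1 / (n : ℂ)) * ∑ i ∈ Finset.range n, (u i * fourierChar (-k) (X i ω) - E) := by
    intro n u E k hn
    have hn0 : (n : ℂ) ≠ 0 := by
      have : n ≠ 0 := by omega
      exact_mod_cast this
    rw [empCoeff, Finset.sum_sub_distrib, mul_sub]
    simp [hn0]
  filter_upwards [h1, h2, hrate, hvK] with n h1 h2 hrate hvK
  have hR := hrate.mono (K' := (K : ℝ)) (by linarith [le_abs_self K₀])
  have hcm : 0 < c n ^ m := pow_pos (hc n) m
  have hc1 : c n ≤ 1 := by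
    by_contra! hcon
    have h6 := Real.one_lt_rpow hcon ht
    have h7 : (K : ℝ) * v n ≤ 6 * (K : ℝ) ^ 4 * v n := by
      have h8 : (K : ℝ) ≤ 6 * (K : ℝ) ^ 4 := by
        have := pow_le_pow_right₀ hK1 (show 1 ≤ 4 by norm_num)
        rw [pow_one] at this
        linarith
      exact mul_le_mul_of_nonneg_right h8 hR.v_pos.le
    linarith [hR.rpow_le]
  have hl : 0 ≤ Real.log n := Real.log_natCast_nonneg n
  refine norm_smoothingError_le (g := g) (γ := cubeCoeff g) (a := a) (M := (c n ^ m)⁻¹)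
    (r := Real.log n / √n) (le_trans (by norm_num) hR.three_le) hΛ1 (hc n) hR.summable ht hK1
    ((one_le_inv₀ hcm).2 (pow_le_one₀ (hc n).le hc1)) (by positivity) hR.v_le_one hR.mass_le
    (mul_inv_cancel₀ hcm.ne') hR.rpow_le hR.rate_le hvK hγ (by linarith) hγp (by linarith)
    (fun k => ?_) (fun i => (h3 i).1) (fun i => ?_) ha hap (by linarith) (fun i => hf _)
    (fun i => (hfb _).trans (by linarith)) (fun k => ?_)
  · rw [hemp n _ _ k hR.three_le]
    refine norm_inv_mul_le_freqWeight hR.three_le hR.inv_le (abs_nonneg C1) (by linarith) ?_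
    refine le_trans (by simpa using h1 k) (mul_le_mul_of_nonneg_right (le_abs_self C1) ?_)
    have := Real.log_nonneg (by linarith [norm_nonneg (latticePoint k)] :
      (1 : ℝ) ≤ 2 + ‖latticePoint k‖)
    positivity
  · refine le_trans ?_ (h3 i).2.2
    rw [one_div, inv_le_comm₀ (by linarith) hα, ← one_div]
    linarith
  · rw [hemp n _ _ k hR.three_le]
    refine norm_inv_mul_le_freqWeight hR.three_le hR.inv_le (abs_nonneg C2) (by linarith) ?_
    have h5 := h2 k
    have h9 : ∀ i, ((f (X i ω) / G (X i ω) : ℝ) : ℂ) = (f (X i ω) : ℂ) / (g (X i ω) : ℂ) := by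
      intro i
      rw [(h3 i).2.1]
      push_cast
      rfl
    simp only [h9] at h5
    refine le_trans h5 (mul_le_mul_of_nonneg_right (le_abs_self C2) ?_)
    have := Real.log_nonneg (by linarith [norm_nonneg (latticePoint k)] :
      (1 : ℝ) ≤ 2 + ‖latticePoint k‖)
    positivity

end Design

/-! ### The residual mean and the residual variance -/

theorem mainTheorem3 {m : ℕ} (hm : 1 ≤ m)
    {Ω : Type*} [MeasurableSpace Ω] (μ : Measure Ω) [IsProbabilityMeasure μ]
    (X : ℕ → Ω → EuclideanSpace ℝ (Fin m)) (ε Y : ℕ → Ω → ℝ)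
    (θ ψ Λ : EuclideanSpace ℝ (Fin m) → ℝ) (c : ℕ → ℝ)
    -- the indirect regression model
    (hX_meas : ∀ j, Measurable (X j)) (hε_meas : ∀ j, Measurable (ε j))
    (hX_indep : iIndepFun X μ) (hε_indep : iIndepFun ε μ)
    (hX_ident : ∀ j, IdentDistrib (X j) (X 0) μ μ)
    (hε_ident : ∀ j, IdentDistrib (ε j) (ε 0) μ μ)
    (hXε : IndepFun (fun ω j => X j ω) (fun ω j => ε j ω) μ)
    (hX_cube : ∀ᵐ ω ∂μ, X 0 ω ∈ unitCube m)
    (hε_int : Integrable (ε 0) μ) (hε_mean : ∫ ω, ε 0 ω ∂μ = 0)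
    (hε_density : μ.map (ε 0) ≪ volume)
    (hθ : MemLp θ 2 (volume.restrict (unitCube m))) (hψ : IsDistortion ψ)
    (hY : ∀ j ω, Y j ω = convOp ψ θ (X j ω) + ε j ω)
    -- smoothing parameters and kernel
    (hc : ∀ n, 0 < c n) (hΛ : RadiallySymmetric Λ) :
    -- first assertion, for every sample for which the estimator is defined
    (∀ (n : ℕ) (ω : Ω),
      (Summable fun k : Fin m → ℤ => |Λ (c n • latticePoint k)|) →
      (∀ j ∈ Finset.range n, densityEst Λ (c n) n (fun i => X i ω) (X j ω) ≠ 0) →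
      ‖(1 / (n : ℂ)) * ∑ j ∈ Finset.range n,
          (regressionEst Λ (c n) n (fun i => X i ω) (fun i => Y i ω) (X j ω)
            - (convOp ψ θ (X j ω) : ℂ))
        - (1 / (n : ℂ)) * ∑ j ∈ Finset.range n, (ε j ω : ℂ)‖ = 0) ∧
    -- second assertion
    (∀ (s₀ b κ : ℝ) (g : EuclideanSpace ℝ (Fin m) → ℝ),
      0 < s₀ → MemSmoothClass s₀ θ →
      IllPosedOfDegree b ψ →
      IsFourierKernel Λ →
      (Integrable fun u => ‖u‖ ^ max (s₀ + b) 1 * |Λ u|) →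
      BoundedRiemannSums Λ c →
      IsRegularDensity (s₀ + b + m) g →
      μ.map (X 0) = (volume.restrict (unitCube m)).withDensity (fun x => ENNReal.ofReal (g x)) →
      2 < κ → MemLp (ε 0) (ENNReal.ofReal κ) μ →
      (c =Θ[atTop] fun n : ℕ =>
        (n : ℝ) ^ (-(1 / (2 * s₀ + 2 * b + 3 * m))) *
          Real.log n ^ (1 / (2 * s₀ + 2 * b + 3 * m))) →
      3 * (m : ℝ) / 2 < s₀ + b →
      (∀ᵐ ω ∂μ, ∀ᶠ n in atTop, ∀ j ∈ Finset.range n,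
        densityEst Λ (c n) n (fun i => X i ω) (X j ω) ≠ 0) ∧
      ∀ᵐ ω ∂μ,
        (fun n : ℕ => |sigmaHat Λ (c n) n (fun i => X i ω) (fun i => Y i ω) ^ 2
            - variance (ε 0) μ
            - (1 / (n : ℝ)) * ∑ j ∈ Finset.range n, (ε j ω ^ 2 - variance (ε 0) μ)|)
          =o[atTop] fun n : ℕ => (n : ℝ) ^ (-(1 / 2 : ℝ))) := by
  refine ⟨fun n ω hs hd => ?_, ?_⟩
  · have h1 := mean_regressionEst hΛ hs hd (fun i => Y i ω)
    rw [Finset.sum_sub_distrib, mul_sub, h1]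
    simp only [hY, Complex.ofReal_add, Finset.sum_add_distrib, mul_add]
    simp
  intro s₀ b κ g hs₀ hθs hb hΛ1 _ hR hg hlaw hκ hεκ hcΘ ht
  have hm' : (1 : ℝ) ≤ m := by exact_mod_cast hm
  have ht0 : 0 < s₀ + b := by linarith
  have hε2 : MemLp (ε 0) 2 μ := hεκ.mono_exponent (by
    rw [← ENNReal.ofReal_ofNat]
    exact ENNReal.ofReal_le_ofReal hκ.le)
  set f := convOp ψ θ with hf
  set a : (Fin m → ℤ) → ℂ := fun k => cubeCoeff θ k * cubeCoeff ψ k with ha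
  have hap := summable_rpow_mul_cubeCoeff_mul hs₀ hθs hψ hb
  have hfa : ∀ x, (f x : ℂ) = ∑' k, a k * fourierChar k x := fun x =>
    (hasSum_convOp hψ hθ x).tsum_eq.symm
  have hfm : Measurable f := by
    have h1 : f = fun x => (∑' k, a k * fourierChar k x).re := by
      funext x
      rw [← hfa, Complex.ofReal_re]
    rw [h1]
    exact Complex.measurable_re.comp (continuous_tsum_mul_fourierChar
      (summable_norm_of_summable_rpow_mul ht0.le hap)).measurable
  rw [show 2 * s₀ + 2 * b + 3 * (m : ℝ) = 2 * (s₀ + b) + 3 * m by ring] at hcΘ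
  obtain ⟨K₀, v, hK₀, hv0, hv2, hrate⟩ := exists_rateBounds hm hc hΛ1 hR ht hcΘ
  have hdesign := ae_design_bounds hX_meas hX_indep hX_ident hlaw hΛ1 hc ht0 hg hap hfa hv0 hrate
  have hXm : Measurable fun ω j => X j ω := measurable_pi_lambda _ hX_meas
  refine ⟨?_, ?_⟩
  · filter_upwards [hdesign] with ω hω
    obtain ⟨K, hK1, hK⟩ := hω
    filter_upwards [hK] with n hn j _ h0
    have h1 := hn.1 j
    rw [h0, norm_zero] at h1
    have h2 : (1 : ℝ) ≤ K := by exact_mod_cast hK1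
    have h3 : 0 < 1 / (2 * (K : ℝ)) := by positivity
    linarith
  have hchar : ∀ (k : Fin m → ℤ) (i : ℕ),
      Measurable fun x : ℕ → EuclideanSpace ℝ (Fin m) => fourierChar k (x i) := fun k i =>
    (continuous_fourierChar k).measurable.comp (measurable_pi_apply i)
  -- The three arrays of weights on the errors: the characters, the characters divided by the
  -- density estimate, and the normalized smoothing error.
  have hE1 := ae_eventually_norm_weighted_sum_le_of_indepFun hXm hε_meas hε_indep hε_ident hε_mean
    hε2 hXε (fun x _ k i => fourierChar (-k) (x i)) (fun n k i => hchar (-k) i)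
    (Eventually.of_forall fun ω => ⟨1, Eventually.of_forall fun n k i _ => by
      rw [norm_fourierChar, Nat.cast_one]⟩)
  have hE2 := ae_eventually_norm_weighted_sum_le_of_indepFun hXm hε_meas hε_indep hε_ident hε_mean
    hε2 hXε (fun x n k i => fourierChar (-k) (x i) / densityEst Λ (c n) n x (x i))
    (fun n k i => (hchar (-k) i).div (measurable_densityEst_design Λ (c n) n i)) (by
      filter_upwards [hdesign] with ω hω
      obtain ⟨K, hK1, hK⟩ := hω
      have h2 : (1 : ℝ) ≤ K := by exact_mod_cast hK1
      refine ⟨2 * K, ?_⟩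
      filter_upwards [hK] with n hn k i _
      rw [norm_div, norm_fourierChar]
      push_cast
      rw [one_div, inv_le_comm₀ (lt_of_lt_of_le (by positivity) (hn.1 i)) (by positivity),
        ← one_div]
      exact hn.1 i)
  -- The lattice index plays no role in the third array, which is used at the frequency `0`.
  have hE3 := ae_eventually_norm_weighted_sum_le_of_indepFun (m := m) hXm hε_meas hε_indep hε_ident
    hε_mean hε2 hXε (fun x n _ i => smoothingError Λ (c n) n x f i / (v n : ℂ))
    (fun n k i => (measurable_smoothingError Λ (c n) n i hfm).div_const _) (by
      filter_upwards [hdesign] with ω hω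
      obtain ⟨K, hK1, hK⟩ := hω
      refine ⟨15 * K ^ 8, ?_⟩
      filter_upwards [hK, hrate] with n hn hr k i _
      have hv := hr.v_pos
      rw [norm_div, Complex.norm_real, Real.norm_of_nonneg hv.le, div_le_iff₀ hv]
      push_cast
      exact hn.2 i)
  filter_upwards [hdesign, hE1, hE2, hE3] with ω hω h1 h2 h3
  obtain ⟨K₁, hK₁, hω⟩ := hω
  obtain ⟨C1, h1⟩ := h1
  obtain ⟨C2, h2⟩ := h2
  obtain ⟨C3, h3⟩ := h3
  set K : ℝ := 1 + K₀ + K₁ + 4 * C1 + 4 * C2 + 4 * C3 with hK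
  have p1 : (0 : ℝ) ≤ K₁ := Nat.cast_nonneg _
  have p2 : (0 : ℝ) ≤ C1 := Nat.cast_nonneg _
  have p3 : (0 : ℝ) ≤ C2 := Nat.cast_nonneg _
  have p4 : (0 : ℝ) ≤ C3 := Nat.cast_nonneg _
  have hK1 : 1 ≤ K := by linarith
  refine IsBigO.trans_isLittleO (g := fun n => v n ^ 2) ?_ hv2
  refine IsBigO.of_bound (260 * K ^ 16) ?_
  have hKv : ∀ᶠ n in atTop, K * v n < 1 := by
    have h4 : Tendsto (fun n => K * v n) atTop (nhds 0) := by simpa using hv0.const_mul K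
    exact h4.eventually_lt_const one_pos
  filter_upwards [hω, h1, h2, h3, hrate, hKv] with n hω h1 h2 h3 hrate hKv
  have hr := hrate.mono (K' := K) (by linarith)
  have hn3 := hr.three_le
  have hn0 : (n : ℝ) ≠ 0 := by
    have : n ≠ 0 := by omega
    exact_mod_cast this
  have hcm : 0 < c n ^ m := pow_pos (hc n) m
  have hc1 : c n ≤ 1 := by
    by_contra! hcon
    linarith [Real.one_lt_rpow hcon ht0, hr.rpow_le]
  have hM : 1 ≤ (c n ^ m)⁻¹ := (one_le_inv₀ hcm).2 (pow_le_one₀ (hc n).le hc1)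
  have hsM : 1 ≤ √((c n ^ m)⁻¹) := by rwa [Real.one_le_sqrt]
  have hl : 0 ≤ Real.log n := Real.log_natCast_nonneg n
  have hr0 : 0 ≤ Real.log n / √n := by positivity
  have hrM : Real.log n / √n * (c n ^ m)⁻¹ ≤ K * v n :=
    (le_mul_of_one_le_right (by positivity) hsM).trans hr.rate_le
  have hvar : (1 / (n : ℝ)) * ∑ j ∈ Finset.range n, (ε j ω ^ 2 - variance (ε 0) μ) =
      (1 / (n : ℝ)) * ∑ j ∈ Finset.range n, ε j ω ^ 2 - variance (ε 0) μ := by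
    rw [Finset.sum_sub_distrib, mul_sub]
    simp [hn0]
  rw [hvar, Real.norm_of_nonneg (abs_nonneg _), Real.norm_of_nonneg (sq_nonneg _),
    sub_sub_sub_cancel_right]
  have key := abs_sigmaHat_sq_sub_le (Λ := Λ) (c := c n) (n := n) (x := fun i => X i ω) (K := K)
    (M := (c n ^ m)⁻¹) (r := Real.log n / √n) (v := v n) (f := f) (e := fun i => ε i ω)
    (y := fun i => Y i ω) (le_trans (by norm_num) hn3) hr.summable hK1 hM hr0 hr.v_pos.le
    hr.mass_le hrM ((le_mul_of_one_le_right hr0 hM).trans hrM) (fun i => hY i ω)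
    (fun j => (hω.2 j).trans (by
      have hv := hr.v_pos
      gcongr
      linarith))
    (fun k => by
      refine norm_inv_mul_le_freqWeight hn3 hr.inv_le p2 (by linarith)
        (le_trans (le_of_eq ?_) (h1 k))
      congr 1
      exact Finset.sum_congr rfl fun i _ => mul_comm _ _)
    (fun k => by
      refine norm_inv_mul_le_freqWeight hn3 hr.inv_le p3 (by linarith)
        (le_trans (le_of_eq ?_) (h2 k))
      congr 1
      exact Finset.sum_congr rfl fun i _ => by ring)
    (by
      have hv := hr.v_pos
      have hv' : (v n : ℂ) ≠ 0 := by exact_mod_cast hv.ne'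
      have h4 := norm_inv_mul_le_freqWeight hn3 hr.inv_le p4 (by linarith : 4 * (C3 : ℝ) ≤ K) (h3 0)
      have h5 : freqWeight (c n) (0 : Fin m → ℤ) = 1 := by simp [freqWeight, latticePoint_zero]
      have h6 : (1 / (n : ℂ)) * ∑ j ∈ Finset.range n, ((ε j ω : ℝ) : ℂ) *
            smoothingError Λ (c n) n (fun i => X i ω) f j =
          ((1 / (n : ℂ)) * ∑ j ∈ Finset.range n,
            smoothingError Λ (c n) n (fun i => X i ω) f j / (v n : ℂ) * ((ε j ω : ℝ) : ℂ)) *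
              (v n : ℂ) := by
        rw [mul_assoc, Finset.sum_mul]
        congr 1
        refine Finset.sum_congr rfl fun j _ => ?_
        field_simp
      rw [h5, mul_one] at h4
      rw [h6, norm_mul, Complex.norm_real, Real.norm_of_nonneg hv.le]
      exact mul_le_mul_of_nonneg_right h4 hv.le)
  exact key
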